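/- Let $R$ be an associative unital topological ring which is complete and separated and which has a countable base of neighbourhoods of zero consisting of open right ideals. For a set $X$, let $R[[X]]$ be the set of all formal linear combinations $\sum_{x\in X} a_x x$ with coefficients $a_x\in R$ converging to zero (every neighbourhood of zero contains all but finitely many of the $a_x$). With the point measures $X\to R[[X]]$ and the opening of parentheses $R[[R[[X]]]]\to R[[X]]$ (defined by infinite summation in $R$), the functor $X\mapsto R[[X]]$ is a monad on the category of sets; a *left $R$-contramodule* is an algebra $(P,\ \pi_P\colon R[[P]]\to P)$ over this monad. Left $R$-contramodules form a cocomplete abelian category $R\text{-}\mathrm{Contra}$. A right $R$-module $N$ is *discrete* if every element of $N$ is annihilated by some open right ideal of $R$. The *contratensor product* $N\odot_R P$ of a discrete right $R$-module $N$ and a left $R$-contramodule $P$ is the quotient group of $N\otimes_{\mathbb Z}P$ by the subgroup generated by all elements $b\otimes\pi_P\bigl(\sum_x r_xp_x\bigr)-\sum_x br_x\otimes p_x$, where $b\in N$, and $(r_x)_{x\in X}$ and $(p_x)_{x\in X}$ are families of elements of $R$ and $P$ indexed by a set $X$, with $r_x$ converging to zero. A left $R$-contramodule $F$ is *flat* if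 $N\mapsto N\odot_R F$ is an exact functor on the abelian category of discrete right $R$-modules. Let $\mathcal C$ be a small filtered category. (1) Let $(0\to Q_i\to P_i\to F_i\to 0)_{i\in\mathcal C}$ be a $\mathcal C$-indexed diagram of short exact sequences of left $R$-contramodules such that every $F_i$ is flat. Then the short sequence of colimits $$0\longrightarrow \operatorname{colim}_i Q_i\longrightarrow \operatorname{colim}_i P_i\longrightarrow \operatorname{colim}_i F_i\longrightarrow 0$$ is exact in $R\text{-}\mathrm{Contra}$. (2) The left derived functors ${}_n\!\operatorname{colim}_{\mathcal C}$ of the colimit functor $\operatorname{colim}_{\mathcal C}\colon (R\text{-}\mathrm{Contra})^{\mathcal C}\to R\text{-}\mathrm{Contra}$ vanish on diagrams of flat contramodules: if $(F_i)_{i\in\mathcal C}$ is a $\mathcal C$-indexed diagram of flat left $R$-contramodules, then ${}_n\!\operatorname{colim}_{i\in\mathcal C}F_i=0$ for all $n\ge 1$. -/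

import Mathlib

open CategoryTheory CategoryTheory.Limits Topology
open scoped TensorProduct

set_option linter.unusedSectionVars false

universe u v w

/-- The group `R[[X]]` of formal infinite linear combinations `∑ aₓ x` whose family of
coefficients converges to zero: every neighbourhood of zero contains all but finitely many `aₓ`. -/
def nullFamilies (R : Type u) [Ring R] [TopologicalSpace R] [IsTopologicalRing R]
    (X : Type v) : AddSubgroup (X → R) where
  carrier := {a | Filter.Tendsto a Filter.cofinite (𝓝 0)}
  zero_mem' := tendsto_const_nhds
  add_mem' {a b} ha hb := by simpa using! Filter.Tendsto.add ha hb
  neg_mem' {a} ha := by simpa using! Filter.Tendsto.neg ha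

/-- The type `R[[X]]`. -/
abbrev FormalSum (R : Type u) [Ring R] [TopologicalSpace R] [IsTopologicalRing R]
    (X : Type v) : Type (max u v) := ↥(nullFamilies R X)

namespace FormalSum

variable {R : Type u} [Ring R] [UniformSpace R] [IsUniformAddGroup R] [IsTopologicalRing R]
  [CompleteSpace R] [T0Space R] [IsLinearTopology Rᵐᵒᵖ R]
  {X : Type*} {Y : Type*} {Z : Type*}

theorem tendsto_zero_iff {ι : Type*} {a : ι → R} : Filter.Tendsto a Filter.cofinite (𝓝 0) ↔
    ∀ I : Submodule Rᵐᵒᵖ R, IsOpen (I : Set R) → {x | a x ∉ I}.Finite := by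
  rw [(IsLinearTopology.hasBasis_open_submodule Rᵐᵒᵖ (M := R)).tendsto_right_iff]
  rfl

theorem mul_mem_of_mem {I : Submodule Rᵐᵒᵖ R} {a : R} (ha : a ∈ I) (r : R) : a * r ∈ I := by
  simpa using I.smul_mem (MulOpposite.op r) ha

theorem tsum_mem_ideal {ι : Type*} {I : Submodule Rᵐᵒᵖ R} (hI : IsOpen (I : Set R)) {a : ι → R}
    (h : ∀ i, a i ∈ I) : ∑' i, a i ∈ I :=
  tsum_mem (I.toAddSubgroup.isClosed_of_isOpen hI) h

theorem exists_mul_mem (I : Submodule Rᵐᵒᵖ R) (hI : IsOpen (I : Set R)) (r : R) :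
    ∃ I' : Submodule Rᵐᵒᵖ R, IsOpen (I' : Set R) ∧ ∀ s ∈ I', r * s ∈ I := by
  have hc : Filter.Tendsto (fun s : R => r * s) (𝓝 0) (𝓝 0) := by
    simpa using (continuous_const_mul r).tendsto (0 : R)
  obtain ⟨I', hI', h⟩ := (((IsLinearTopology.hasBasis_open_submodule Rᵐᵒᵖ (M := R)).tendsto_iff
    (IsLinearTopology.hasBasis_open_submodule Rᵐᵒᵖ (M := R))).1 hc) I hI
  exact ⟨I', hI', h⟩

theorem summable_of_tendsto {ι : Type*} {a : ι → R} (h : Filter.Tendsto a Filter.cofinite (𝓝 0)) :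
    Summable a := by
  have : NonarchimedeanAddGroup R :=
    { is_nonarchimedean := fun U hU => by
        obtain ⟨I, hI, hIU⟩ :=
          (IsLinearTopology.hasBasis_open_submodule Rᵐᵒᵖ (M := R)).mem_iff.1 hU
        exact ⟨⟨I.toAddSubgroup, hI⟩, hIU⟩ }
  exact NonarchimedeanAddGroup.summable_of_tendsto_cofinite_zero h

theorem tendsto_mul (a : FormalSum R X) (g : X → R) :
    Filter.Tendsto (fun x => a.1 x * g x) Filter.cofinite (𝓝 0) := by
  rw [tendsto_zero_iff]
  intro I hI
  exact (tendsto_zero_iff.1 a.2 I hI).subset fun x hx h => hx (mul_mem_of_mem h _)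

/-- The weighted sum `∑ aₓ gₓ` of an arbitrary family `g` of elements of `R`. -/
noncomputable def pair (a : FormalSum R X) (g : X → R) : R := ∑' x, a.1 x * g x

theorem summable_pair (a : FormalSum R X) (g : X → R) : Summable fun x => a.1 x * g x :=
  summable_of_tendsto (tendsto_mul a g)

open Classical in
theorem pair_single (a : FormalSum R X) (x : X) : pair a (Pi.single x 1) = a.1 x := by
  unfold pair
  rw [tsum_eq_single x]
  · simp
  · intro y hy
    simp [Pi.single_eq_of_ne hy]

theorem ext_pair {a b : FormalSum R X} (h : ∀ g, pair a g = pair b g) : a = b := by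
  classical
  ext x
  rw [← pair_single, ← pair_single, h]

theorem pair_add_left (a b : FormalSum R X) (g : X → R) : pair (a + b) g = pair a g + pair b g := by
  unfold pair
  rw [← (summable_pair a g).tsum_add (summable_pair b g)]
  simp [add_mul]

theorem pair_neg_left (a : FormalSum R X) (g : X → R) : pair (-a) g = - pair a g := by
  unfold pair
  rw [← tsum_neg]
  simp

theorem pair_zero_left (g : X → R) : pair (0 : FormalSum R X) g = 0 := by
  simp [pair]

theorem pair_add_right (a : FormalSum R X) (g h : X → R) :
    pair a (fun x => g x + h x) = pair a g + pair a h := by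
  unfold pair
  rw [← (summable_pair a g).tsum_add (summable_pair a h)]
  simp [mul_add]

theorem pair_neg_right (a : FormalSum R X) (g : X → R) :
    pair a (fun x => - g x) = - pair a g := by
  unfold pair
  rw [← tsum_neg]
  simp

theorem pair_zero_right (a : FormalSum R X) : pair a (fun _ => 0) = 0 := by
  simp [pair]

/-- The direct image push `R[[f]] : R[[X]] → R[[Y]]`, taking `∑ aₓ x` to the formal linear
combination whose coefficient at `y` is the sum of `aₓ` over all `x` with `f x = y`. -/
noncomputable def push (f : X → Y) (a : FormalSum R X) : FormalSum R Y :=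
  ⟨fun y => ∑' x : {x // f x = y}, a.1 x, by
    change Filter.Tendsto _ _ _
    rw [tendsto_zero_iff]
    intro I hI
    refine ((tendsto_zero_iff.1 a.2 I hI).image f).subset ?_
    intro y hy
    by_contra hne
    refine hy (tsum_mem_ideal hI fun x => ?_)
    by_contra hx
    exact hne ⟨x.1, hx, x.2⟩⟩

/-- The point measure push `X → R[[X]]`. -/
noncomputable def point (x : X) : FormalSum R X := by
  classical
  exact ⟨Pi.single x 1, by
    refine tendsto_nhds_of_eventually_eq ?_
    rw [Filter.eventually_cofinite]
    refine (Set.finite_singleton x).subset fun y hy => ?_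
    by_contra hne
    exact hy (Pi.single_eq_of_ne hne _)⟩

theorem tendsto_mul_mul (s : FormalSum R (FormalSum R X)) (g : X → R) :
    Filter.Tendsto (fun p : FormalSum R X × X => s.1 p.1 * (p.1.1 p.2 * g p.2)) Filter.cofinite (𝓝 0) := by
  rw [tendsto_zero_iff]
  intro I hI
  have hF := tendsto_zero_iff.1 s.2 I hI
  choose J hJ hJI using fun t : FormalSum R X => exists_mul_mem I hI (s.1 t)
  refine (hF.biUnion fun t _ => (tendsto_zero_iff.1 t.2 (J t) (hJ t)).image (Prod.mk t)).subset ?_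
  rintro ⟨t, x⟩ h
  simp only [Set.mem_iUnion]
  refine ⟨t, fun ht => h (mul_mem_of_mem ht _), x, fun hx => h ?_, rfl⟩
  exact hJI t _ (mul_mem_of_mem hx _)

/-- Opening of parentheses `R[[R[[X]]]] → R[[X]]`: the coefficient at `x` of the image of
`∑ sₜ t` is the infinite sum `∑ sₜ tₓ`. -/
noncomputable def join (s : FormalSum R (FormalSum R X)) : FormalSum R X :=
  ⟨fun x => ∑' t, s.1 t * t.1 x, by
    change Filter.Tendsto _ _ _
    rw [tendsto_zero_iff]
    intro I hI
    have h := tendsto_zero_iff.1 (tendsto_mul_mul s fun _ => 1) I hI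
    refine (h.image Prod.snd).subset ?_
    intro x hx
    by_contra hne
    refine hx (tsum_mem_ideal hI fun t => ?_)
    by_contra ht
    exact hne ⟨(t, x), by simpa using ht, rfl⟩⟩

theorem pair_push (f : X → Y) (a : FormalSum R X) (g : Y → R) :
    pair (push f a) g = pair a (fun x => g (f x)) := by
  have hs := summable_pair a (fun x => g (f x))
  have hs' : Summable ((fun x => a.1 x * g (f x)) ∘ Equiv.sigmaFiberEquiv f) :=
    (Equiv.sigmaFiberEquiv f).summable_iff.2 hs
  unfold pair
  rw [← (Equiv.sigmaFiberEquiv f).tsum_eq (fun x => a.1 x * g (f x))]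
  refine Eq.trans ?_ (Summable.tsum_sigma' (fun y => hs'.sigma_factor y) hs').symm
  refine tsum_congr fun y => ?_
  have : Summable fun x : {x // f x = y} => a.1 x :=
    (summable_of_tendsto a.2).comp_injective Subtype.val_injective
  change (∑' x : {x // f x = y}, a.1 x) * g y = _
  rw [← this.tsum_mul_right]
  refine tsum_congr fun x => ?_
  simp [Equiv.sigmaFiberEquiv, x.2]

theorem pair_point (x : X) (g : X → R) : pair (point x) g = g x := by
  classical
  unfold pair
  rw [tsum_eq_single x]
  · simp [point]
  · intro y hy
    simp [point, Pi.single_eq_of_ne hy]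

theorem pair_join (s : FormalSum R (FormalSum R X)) (g : X → R) :
    pair (join s) g = pair s (fun t => pair t g) := by
  have h := summable_of_tendsto (tendsto_mul_mul s g)
  unfold pair
  calc ∑' x, (∑' t, s.1 t * t.1 x) * g x = ∑' x, ∑' t, s.1 t * (t.1 x * g x) := by
        refine tsum_congr fun x => ?_
        rw [← (summable_pair s fun t => t.1 x).tsum_mul_right]
        simp [mul_assoc]
    _ = ∑' t, ∑' x, s.1 t * (t.1 x * g x) :=
        Summable.tsum_comm (f := fun t x => s.1 t * (t.1 x * g x)) h
    _ = ∑' t, s.1 t * ∑' x, t.1 x * g x := by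
        refine tsum_congr fun t => ?_
        rw [← (summable_pair t g).tsum_mul_left]

theorem push_id (a : FormalSum R X) : push (fun x => x) a = a :=
  ext_pair fun g => by rw [pair_push]

theorem push_push (f : X → Y) (g : Y → Z) (a : FormalSum R X) :
    push g (push f a) = push (fun x => g (f x)) a :=
  ext_pair fun h => by simp only [pair_push]

theorem push_point (f : X → Y) (x : X) : push f (point x : FormalSum R X) = point (f x) :=
  ext_pair fun h => by simp only [pair_push, pair_point]

theorem push_add (f : X → Y) (a b : FormalSum R X) : push f (a + b) = push f a + push f b :=
  ext_pair fun h => by simp only [pair_push, pair_add_left]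

theorem push_neg (f : X → Y) (a : FormalSum R X) : push f (-a) = - push f a :=
  ext_pair fun h => by simp only [pair_push, pair_neg_left]

theorem join_point (a : FormalSum R X) : join (point a) = a :=
  ext_pair fun h => by simp only [pair_join, pair_point]

theorem join_push_point (a : FormalSum R X) : join (push point a) = a :=
  ext_pair fun h => by simp only [pair_join, pair_push, pair_point]

theorem join_join (s : FormalSum R (FormalSum R (FormalSum R X))) :
    join (join s) = join (push join s) :=
  ext_pair fun h => by simp only [pair_join, pair_push]

theorem join_push_push (f : X → Y) (s : FormalSum R (FormalSum R X)) :
    join (push (push f) s) = push f (join s) :=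
  ext_pair fun h => by simp only [pair_join, pair_push]

theorem join_add (s t : FormalSum R (FormalSum R X)) : join (s + t) = join s + join t :=
  ext_pair fun h => by simp only [pair_join, pair_add_left]

theorem join_neg (s : FormalSum R (FormalSum R X)) : join (-s) = - join s :=
  ext_pair fun h => by simp only [pair_join, pair_neg_left]

end FormalSum

/-- A left `R`-contramodule structure on a set `P`: an algebra over the monad `X ↦ R[[X]]`, that is
a contraaction push `R[[P]] → P` that is contraunital and contraassociative. -/
class Contramodule (R : Type u) [Ring R] [UniformSpace R] [IsUniformAddGroup R]
    [IsTopologicalRing R] [CompleteSpace R] [T0Space R] [IsLinearTopology Rᵐᵒᵖ R]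
    (P : Type v) where
  /-- The contraaction push, `∑ rₚ p ↦ π (∑ rₚ p)`. -/
  act : FormalSum R P → P
  act_point : ∀ p : P, act (FormalSum.point p) = p
  act_join : ∀ s : FormalSum R (FormalSum R P),
    act (FormalSum.join s) = act (FormalSum.push act s)

/-- The type of left `R`-contramodules. -/
structure ContraMod (R : Type u) [Ring R] [UniformSpace R] [IsUniformAddGroup R]
    [IsTopologicalRing R] [CompleteSpace R] [T0Space R] [IsLinearTopology Rᵐᵒᵖ R] :
    Type (u + 1) where
  /-- The underlying set. -/
  carrier : Type u
  [str : Contramodule R carrier]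

noncomputable section

namespace ContraMod

open FormalSum

variable {R : Type u} [Ring R] [UniformSpace R] [IsUniformAddGroup R] [IsTopologicalRing R]
  [CompleteSpace R] [T0Space R] [IsLinearTopology Rᵐᵒᵖ R]

instance : CoeSort (ContraMod R) (Type u) := ⟨ContraMod.carrier⟩

/-- The contraaction push of a contramodule. -/
def act (P : ContraMod R) : FormalSum R P → P := P.str.act

section Structure

variable (P : ContraMod R) {X : Type*}

theorem act_point (p : P) : P.act (point p) = p := P.str.act_point p

theorem act_join (s : FormalSum R (FormalSum R P)) : P.act (join s) = P.act (push P.act s) :=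
  P.str.act_join s

theorem act_push_join (f : X → P) (s : FormalSum R (FormalSum R X)) :
    P.act (push f (join s)) = P.act (push (fun t => P.act (push f t)) s) := by
  rw [← join_push_push, act_join, push_push]

theorem act_push_act (h : X → FormalSum R P) (s : FormalSum R X) :
    P.act (push (fun x => P.act (h x)) s) = P.act (join (push h s)) := by
  rw [act_join, push_push]

instance : Zero P := ⟨P.act 0⟩
instance : Add P := ⟨fun p q => P.act (point p + point q)⟩
instance : Neg P := ⟨fun p => P.act (-point p)⟩

theorem act_zero : P.act 0 = 0 := rfl

theorem act_add (a b : FormalSum R P) : P.act (a + b) = P.act a + P.act b := by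
  change _ = P.act (point (P.act a) + point (P.act b))
  rw [← push_point, ← push_point, ← push_add, ← act_join, join_add, join_point, join_point]

theorem act_neg (a : FormalSum R P) : P.act (-a) = - P.act a := by
  change _ = P.act (-point (P.act a))
  rw [← push_point, ← push_neg, ← act_join, join_neg, join_point]

/-- The additive group underlying a contramodule: `p + q`, `-p` and `0` are the values of the
contraaction on the finite formal linear combinations `1 p + 1 q`, `(-1) p` and `0`. -/
instance : AddCommGroup P where
  add_assoc p q r := by
    rw [← P.act_point p, ← P.act_point q, ← P.act_point r]
    simp only [← act_add, add_assoc]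
  zero_add p := by
    rw [← P.act_point p, ← act_zero, ← act_add, zero_add]
  add_zero p := by
    rw [← P.act_point p, ← act_zero, ← act_add, add_zero]
  neg_add_cancel p := by
    rw [← P.act_point p, ← act_neg, ← act_add, neg_add_cancel, act_zero]
  add_comm p q := by
    rw [← P.act_point p, ← P.act_point q]
    simp only [← act_add, add_comm]
  nsmul := nsmulRec
  zsmul := zsmulRec

theorem act_push_add (f g : X → P) (s : FormalSum R X) :
    P.act (push (fun x => f x + g x) s) = P.act (push f s) + P.act (push g s) := by
  rw [← act_add]
  refine (P.act_push_act (fun x => point (f x) + point (g x)) s).trans (congrArg _ ?_)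
  exact ext_pair fun k => by
    simp only [pair_join, pair_push, pair_add_left, pair_point, pair_add_right]

theorem act_push_neg (f : X → P) (s : FormalSum R X) :
    P.act (push (fun x => - f x) s) = - P.act (push f s) := by
  rw [← act_neg]
  refine (P.act_push_act (fun x => - point (f x)) s).trans (congrArg _ ?_)
  exact ext_pair fun k => by
    simp only [pair_join, pair_push, pair_neg_left, pair_point, pair_neg_right]

theorem act_push_sub (f g : X → P) (s : FormalSum R X) :
    P.act (push (fun x => f x - g x) s) = P.act (push f s) - P.act (push g s) := by
  simp only [sub_eq_add_neg, act_push_add, act_push_neg]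

theorem act_push_zero (s : FormalSum R X) : P.act (push (fun _ => 0) s) = 0 := by
  refine (P.act_push_act (fun _ => 0) s).trans ?_
  rw [← act_zero]
  refine congrArg _ (ext_pair fun k => ?_)
  simp only [pair_join, pair_push, pair_zero_left, pair_zero_right]

end Structure

/-- Morphisms of contramodules: maps commuting with the contraactions. -/
@[ext]
structure Hom (P Q : ContraMod R) where
  /-- The underlying push. -/
  toFun : P → Q
  map_act : ∀ s : FormalSum R P, toFun (P.act s) = Q.act (FormalSum.push toFun s)

instance : Category (ContraMod R) where
  Hom P Q := Hom P Q
  id P := ⟨fun p => p, fun s => by rw [push_id]⟩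
  comp f g := ⟨fun p => g.toFun (f.toFun p), fun s => by
    rw [f.map_act, g.map_act, push_push]⟩

variable {P Q T : ContraMod R}

/-- The underlying push of a morphism of contramodules. -/
def fn (f : P ⟶ Q) : P → Q := Hom.toFun f

/-- The morphism of contramodules with a given underlying push. -/
def mkHom (f : P → Q) (h : ∀ s : FormalSum R P, f (P.act s) = Q.act (FormalSum.push f s)) :
    P ⟶ Q := Hom.mk f h

theorem fn_act (f : P ⟶ Q) (s : FormalSum R P) :
    fn f (P.act s) = Q.act (FormalSum.push (fn f) s) := Hom.map_act f s

theorem hom_ext {f g : P ⟶ Q} (h : ∀ p, fn f p = fn g p) : f = g := Hom.ext (funext h)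

theorem fn_id (p : P) : fn (𝟙 P) p = p := rfl

theorem fn_comp (f : P ⟶ Q) (g : Q ⟶ T) (p : P) : fn (f ≫ g) p = fn g (fn f p) := rfl

theorem fn_add (f : P ⟶ Q) (p q : P) : fn f (p + q) = fn f p + fn f q := by
  change fn f (P.act (point p + point q)) = Q.act (point (fn f p) + point (fn f q))
  rw [fn_act, push_add, push_point, push_point]

/-- The additive push underlying a morphism of contramodules. -/
def addHom (f : P ⟶ Q) : P →+ Q := AddMonoidHom.mk' (fn f) (fn_add f)

theorem fn_zero (f : P ⟶ Q) : fn f 0 = 0 := (addHom f).map_zero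
theorem fn_sub (f : P ⟶ Q) (p q : P) : fn f (p - q) = fn f p - fn f q := (addHom f).map_sub p q

instance : Zero (P ⟶ Q) := ⟨mkHom (fun _ => 0) fun s => (Q.act_push_zero s).symm⟩
instance : Add (P ⟶ Q) := ⟨fun f g => mkHom (fun p => fn f p + fn g p) fun s => by
  rw [act_push_add, fn_act, fn_act]⟩
instance : Neg (P ⟶ Q) := ⟨fun f => mkHom (fun p => - fn f p) fun s => by
  rw [act_push_neg, fn_act]⟩

theorem add_fn (f g : P ⟶ Q) (p : P) : fn (f + g) p = fn f p + fn g p := rfl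
instance : AddCommGroup (P ⟶ Q) where
  add_assoc f g h := hom_ext fun p => add_assoc _ _ _
  zero_add f := hom_ext fun p => zero_add _
  add_zero f := hom_ext fun p => add_zero _
  neg_add_cancel f := hom_ext fun p => neg_add_cancel _
  add_comm f g := hom_ext fun p => add_comm _ _
  nsmul := nsmulRec
  zsmul := zsmulRec

instance : Preadditive (ContraMod R) where
  add_comp P Q T f g h := hom_ext fun p =>
    (fn_comp (f + g) h p).trans ((congrArg (fn h) (add_fn f g p)).trans (fn_add h (fn f p) (fn g p)))
  comp_add P Q T f g h := hom_ext fun p => rfl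

/-- The free contramodule `R[[X]]`. -/
def free (R : Type u) [Ring R] [UniformSpace R] [IsUniformAddGroup R]
    [IsTopologicalRing R] [CompleteSpace R] [T0Space R] [IsLinearTopology Rᵐᵒᵖ R]
    (X : Type u) : ContraMod R where
  carrier := FormalSum R X
  str :=
    { act := join
      act_point := join_point
      act_join := join_join }

/-- The basis of the free contramodule. -/
def basis {X : Type u} (x : X) : free R X := (point x : FormalSum R X)

/-- The morphism from a free contramodule determined by the images of the basis elements. -/
def lift {X : Type u} (f : X → P) : free R X ⟶ P :=
  mkHom (fun s => P.act (push f s)) fun s => P.act_push_join f s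

theorem lift_basis {X : Type u} (f : X → P) (x : X) : fn (lift f) (basis x) = f x := by
  change P.act (push f (point x)) = _
  rw [push_point, act_point]

theorem free_ext {X : Type u} {f g : free R X ⟶ P} (h : ∀ x, fn f (basis x) = fn g (basis x)) :
    f = g := by
  refine hom_ext fun s => ?_
  have key : (s : FormalSum R X) = (free R X).act (push basis (s : FormalSum R X)) :=
    (join_push_point (s : FormalSum R X)).symm
  have h' : (fun x => fn f (basis x)) = fun x => fn g (basis x) := funext h
  have hf := (fn_act f _).trans (congrArg P.act (push_push basis (fn f) (s : FormalSum R X)))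
  have hg := (fn_act g _).trans (congrArg P.act (push_push basis (fn g) (s : FormalSum R X)))
  rw [key, hf, hg, h']

/-- A subset closed under the contraaction, as a contramodule. -/
def sub (P : ContraMod R) (S : Set P)
    (h : ∀ s : FormalSum R S, P.act (push Subtype.val s) ∈ S) : ContraMod R where
  carrier := S
  str :=
    { act := fun s => ⟨P.act (push Subtype.val s), h s⟩
      act_point := fun p => Subtype.ext (by
        change P.act (push Subtype.val (point p)) = _
        rw [push_point, act_point])
      act_join := fun s => Subtype.ext (by
        change P.act (push Subtype.val (join s)) = P.act (push Subtype.val (push _ s))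
        rw [act_push_join, push_push]) }

/-- The kernel of a morphism of contramodules. -/
def ker (f : P ⟶ Q) : ContraMod R :=
  sub P {p | fn f p = 0} fun s => by
    have h : (fun x : {p | fn f p = 0} => fn f x.1) = fun _ => 0 := funext fun x => x.2
    change fn f _ = 0
    rw [fn_act, push_push, h, act_push_zero]

/-- The inclusion of the kernel. -/
def kerι (f : P ⟶ Q) : ker f ⟶ P := mkHom Subtype.val fun _ => rfl

theorem kerι_comp (f : P ⟶ Q) : kerι f ≫ f = 0 := hom_ext fun p => p.2

/-- Morphisms killed by `f` factor through the kernel of `f`. -/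
def kerLift (f : P ⟶ Q) (k : T ⟶ P) (h : k ≫ f = 0) : T ⟶ ker f :=
  mkHom (fun t => ⟨fn k t, congrArg (fun m => fn m t) h⟩) fun s => Subtype.ext (by
    refine (fn_act k s).trans (congrArg P.act ?_)
    exact (push_push (fun t => (⟨fn k t, congrArg (fun m => fn m t) h⟩ : {p | fn f p = 0}))
      Subtype.val s).symm)

/-- The inclusion of the kernel is a kernel. -/
def kerIsLimit (f : P ⟶ Q) : IsLimit (KernelFork.ofι (kerι f) (kerι_comp f)) :=
  KernelFork.IsLimit.ofι _ _ (fun k h => kerLift f k h) (fun _ _ => rfl)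
    (fun _ _ _ hm => hom_ext fun t => Subtype.ext (congrArg (fun m => fn m t) hm))

/-- The image of a morphism of contramodules. -/
def range (f : P ⟶ Q) : AddSubgroup Q := (addHom f).range

theorem mem_range {f : P ⟶ Q} {q : Q} : q ∈ range f ↔ ∃ p, fn f p = q := Iff.rfl

theorem act_mem_range (f : P ⟶ Q) {X : Type*} (h : X → Q) (hh : ∀ x, h x ∈ range f)
    (s : FormalSum R X) : Q.act (push h s) ∈ range f := by
  choose σ hσ using fun x => mem_range.1 (hh x)
  refine mem_range.2 ⟨P.act (push σ s), ?_⟩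
  rw [fn_act, push_push]
  simp only [hσ]

theorem act_sub_mem_range (f : P ⟶ Q) {X : Type*} (g h : X → Q)
    (hh : ∀ x, (QuotientAddGroup.mk (g x) : Q ⧸ range f) = QuotientAddGroup.mk (h x))
    (s : FormalSum R X) :
    (QuotientAddGroup.mk (Q.act (push g s)) : Q ⧸ range f) =
      QuotientAddGroup.mk (Q.act (push h s)) := by
  rw [QuotientAddGroup.eq, neg_add_eq_sub, ← act_push_sub]
  refine act_mem_range f _ (fun x => ?_) s
  rw [← neg_add_eq_sub, ← QuotientAddGroup.eq]
  exact hh x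

/-- The cokernel of a morphism of contramodules: the quotient of the target by the image. -/
def coker (f : P ⟶ Q) : ContraMod R where
  carrier := Q ⧸ range f
  str :=
    { act := fun s => QuotientAddGroup.mk (Q.act (push Quotient.out s))
      act_point := fun q => by
        rw [push_point, act_point]
        exact Quotient.out_eq q
      act_join := fun s => by
        rw [act_push_join, push_push]
        exact act_sub_mem_range f _ _ (fun t => (Quotient.out_eq _).symm) s }

/-- The projection onto the cokernel. -/
def cokerπ (f : P ⟶ Q) : Q ⟶ coker f :=
  mkHom (fun q => (QuotientAddGroup.mk q : Q ⧸ range f)) fun s => by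
    change _ = QuotientAddGroup.mk (Q.act (push Quotient.out (push _ s)))
    rw [push_push]
    conv_lhs => rw [← push_id s]
    exact act_sub_mem_range f _ _ (fun t => (Quotient.out_eq _).symm) s

theorem cokerπ_surjective (f : P ⟶ Q) : Function.Surjective (fn (cokerπ f)) :=
  QuotientAddGroup.mk_surjective

theorem cokerπ_eq_zero (f : P ⟶ Q) (q : Q) : fn (cokerπ f) q = 0 ↔ q ∈ range f := by
  rw [← fn_zero (cokerπ f)]
  change (QuotientAddGroup.mk q : Q ⧸ range f) = QuotientAddGroup.mk 0 ↔ _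
  rw [eq_comm, QuotientAddGroup.eq, neg_zero, zero_add]

theorem comp_cokerπ (f : P ⟶ Q) : f ≫ cokerπ f = 0 :=
  hom_ext fun p => (cokerπ_eq_zero f _).2 ⟨p, rfl⟩

/-- A morphism factors through any surjective morphism whose kernel it kills. -/
def descSurj (f : P ⟶ Q) (hf : Function.Surjective (fn f)) (k : P ⟶ T)
    (h : ∀ p, fn f p = 0 → fn k p = 0) : Q ⟶ T :=
  mkHom (fun q => fn k (Function.surjInv hf q)) fun s => by
    have hk : ∀ p p', fn f p = fn f p' → fn k p = fn k p' := fun p p' e => by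
      rw [← sub_eq_zero, ← fn_sub]
      exact h _ (by rw [fn_sub, e, sub_self])
    have e : fn k (Function.surjInv hf (Q.act s)) =
        fn k (P.act (push (Function.surjInv hf) s)) := by
      apply hk
      rw [Function.surjInv_eq hf, fn_act, push_push]
      simp only [Function.surjInv_eq hf, push_id]
    rw [e, fn_act, push_push]

theorem comp_descSurj (f : P ⟶ Q) (hf : Function.Surjective (fn f)) (k : P ⟶ T)
    (h : ∀ p, fn f p = 0 → fn k p = 0) : f ≫ descSurj f hf k h = k :=
  hom_ext fun p => by
    change fn k (Function.surjInv hf (fn f p)) = fn k p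
    rw [← sub_eq_zero, ← fn_sub]
    exact h _ (by rw [fn_sub, Function.surjInv_eq hf, sub_self])

theorem epi_of_surjective (f : P ⟶ Q) (hf : Function.Surjective (fn f)) : Epi f :=
  ⟨fun g h e => hom_ext fun q => by
    obtain ⟨p, rfl⟩ := hf q
    exact congrArg (fun m => fn m p) e⟩

theorem surjective_of_epi (f : P ⟶ Q) [Epi f] : Function.Surjective (fn f) := fun q => by
  have h : cokerπ f = 0 := by
    rw [← cancel_epi f, comp_cokerπ, comp_zero]
  exact (cokerπ_eq_zero f q).1 (congrArg (fun m => fn m q) h)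

theorem injective_of_mono (f : P ⟶ Q) [Mono f] : Function.Injective (fn f) := by
  refine (injective_iff_map_eq_zero (addHom f)).2 fun p hp => ?_
  have h : kerι f = 0 := by
    rw [← cancel_mono f, kerι_comp, zero_comp]
  exact congrArg (fun m : ker f ⟶ P => fn m (⟨p, hp⟩ : {p | fn f p = 0})) h

/-- A surjective morphism killing exactly the image of `f` is a cokernel of `f`. -/
def isColimitOfSurjective (f : P ⟶ Q) (g : Q ⟶ T) (w : f ≫ g = 0)
    (hg : Function.Surjective (fn g)) (hr : ∀ q, fn g q = 0 → q ∈ range f) :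
    IsColimit (CokernelCofork.ofπ g w) :=
  haveI := epi_of_surjective g hg
  CokernelCofork.IsColimit.ofπ _ _
    (fun k h => descSurj g hg k fun q hq => by
      obtain ⟨p, hp⟩ := mem_range.1 (hr q hq)
      rw [← hp]
      exact congrArg (fun m => fn m p) h)
    (fun k h => comp_descSurj g hg k _)
    (fun k h m hm => by
      rw [← cancel_epi g, hm, comp_descSurj])

/-- The product of a family of contramodules. -/
def pi {ι : Type} (F : ι → ContraMod R) : ContraMod R where
  carrier := ∀ i, F i
  str :=
    { act := fun s i => (F i).act (push (fun p => p i) s)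
      act_point := fun p => funext fun i => by
        rw [push_point, act_point]
      act_join := fun s => funext fun i => by
        rw [act_push_join, push_push] }

/-- The projections of a product. -/
def piπ {ι : Type} (F : ι → ContraMod R) (i : ι) : pi F ⟶ F i :=
  mkHom (fun p => p i) fun _ => rfl

/-- The product of a family of contramodules is a categorical product. -/
def piIsLimit {ι : Type} (F : ι → ContraMod R) : IsLimit (Fan.mk (pi F) (piπ F)) :=
  Fan.IsLimit.mk _
    (fun s => mkHom (fun t i => fn (s.proj i) t) fun a => funext fun i => by
      refine (fn_act (s.proj i) a).trans (congrArg (F i).act ?_)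
      exact (push_push (fun t i => fn (s.proj i) t) (fun p : ∀ i, F i => p i) a).symm)
    (fun s i => rfl)
    (fun s m hm => hom_ext fun t => funext fun i => congrArg (fun m => fn m t) (hm i))

instance : HasFiniteProducts (ContraMod R) :=
  ⟨fun _ =>
    have h : ∀ F : Fin _ → ContraMod R, HasProduct F := fun F => ⟨⟨_, piIsLimit F⟩⟩
    ⟨fun K =>
      have := h (K.obj ∘ Discrete.mk)
      hasLimit_of_iso (Discrete.natIsoFunctor (F := K)).symm⟩⟩

instance : HasKernels (ContraMod R) := ⟨fun f => ⟨⟨_, kerIsLimit f⟩⟩⟩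

instance : HasCokernels (ContraMod R) := ⟨fun f => ⟨⟨_, isColimitOfSurjective f (cokerπ f)
  (comp_cokerπ f) (cokerπ_surjective f) fun q => (cokerπ_eq_zero f q).1⟩⟩⟩

instance : IsNormalEpiCategory (ContraMod R) :=
  ⟨fun f _ => ⟨{ W := ker f
                 g := kerι f
                 w := kerι_comp f
                 isColimit := isColimitOfSurjective _ _ _ (surjective_of_epi f)
                  fun q hq => mem_range.2 ⟨(⟨q, hq⟩ : {p | fn f p = 0}), rfl⟩ }⟩⟩

/-- A morphism whose values lie in the image of an injective morphism lifts along it. -/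
def liftInj (f : P ⟶ Q) (hf : Function.Injective (fn f)) (k : T ⟶ Q)
    (h : ∀ t, ∃ p, fn f p = fn k t) : T ⟶ P :=
  mkHom (fun t => (h t).choose) fun s => hf (by
    rw [(h (T.act s)).choose_spec, fn_act, fn_act, push_push]
    exact congrArg (fun m => Q.act (push m s)) (funext fun t => (h t).choose_spec.symm))

theorem liftInj_comp (f : P ⟶ Q) (hf : Function.Injective (fn f)) (k : T ⟶ Q)
    (h : ∀ t, ∃ p, fn f p = fn k t) : liftInj f hf k h ≫ f = k :=
  hom_ext fun t => (h t).choose_spec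

instance : IsNormalMonoCategory (ContraMod R) :=
  ⟨fun f _ => ⟨{ Z := coker f
                 g := cokerπ f
                 w := comp_cokerπ f
                 isLimit := KernelFork.IsLimit.ofι _ _
                  (fun k h => liftInj f (injective_of_mono f) k fun t =>
                    mem_range.1 ((cokerπ_eq_zero f _).1 (congrArg (fun m => fn m t) h)))
                  (fun k h => liftInj_comp f _ k _)
                  (fun k h m hm => by rw [← cancel_mono f, hm, liftInj_comp]) }⟩⟩

/-- The category of left `R`-contramodules is abelian. -/
instance : Abelian (ContraMod R) where

section Colimits

variable {J : Type u} [SmallCategory J] (F : J ⥤ ContraMod R)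

/-- Index set of the relations presenting a colimit. -/
abbrev RelIndex : Type u :=
  (Σ j, FormalSum R (F.obj j)) ⊕ (Σ (j : J) (j' : J), (j ⟶ j') × F.obj j)

/-- The relations presenting a colimit. -/
def colimRel : RelIndex F → free R (Σ j, F.obj j)
  | .inl ⟨j, s⟩ => basis ⟨j, (F.obj j).act s⟩ -
      (free R (Σ j, F.obj j)).act (push (fun x => basis ⟨j, x⟩) s)
  | .inr ⟨j, j', f, x⟩ => basis ⟨j, x⟩ - basis ⟨j', fn (F.map f) x⟩

/-- The projection of the free contramodule on all elements of all terms of a diagram onto the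
colimit. -/
def colimπ : free R (Σ j, F.obj j) ⟶ coker (lift (colimRel F)) := cokerπ (lift (colimRel F))

theorem colimπ_rel (y : RelIndex F) : fn (colimπ F) (colimRel F y) = 0 :=
  (cokerπ_eq_zero _ _).2 (mem_range.2 ⟨basis y, lift_basis _ _⟩)

/-- The colimit cocone of a diagram of contramodules. -/
def colimCocone : Cocone F where
  pt := coker (lift (colimRel F))
  ι :=
    { app := fun j => mkHom (fun x => fn (colimπ F) (basis ⟨j, x⟩)) fun s => by
        have h := colimπ_rel F (.inl ⟨j, s⟩)
        change fn (colimπ F) (_ - _) = 0 at h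
        rw [fn_sub, sub_eq_zero, fn_act, push_push] at h
        exact h
      naturality := fun j j' f => hom_ext fun x => by
        have h := colimπ_rel F (.inr ⟨j, j', f, x⟩)
        change fn (colimπ F) (_ - _) = 0 at h
        rw [fn_sub, sub_eq_zero] at h
        exact h.symm }

theorem lift_colimRel_comp (c : Cocone F) (y : RelIndex F) :
    fn (lift fun a : Σ j, F.obj j => fn (c.ι.app a.1) a.2) (colimRel F y) = 0 := by
  rcases y with ⟨j, s⟩ | ⟨j, j', f, x⟩
  · change fn _ (_ - _) = 0
    rw [fn_sub, sub_eq_zero, fn_act, push_push, lift_basis]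
    simp only [lift_basis]
    exact fn_act _ _
  · change fn _ (_ - _) = 0
    rw [fn_sub, sub_eq_zero, lift_basis, lift_basis]
    exact (congrArg (fun m => fn m x) (c.w f)).symm

theorem colim_desc_aux (c : Cocone F) (p : free R (Σ j, F.obj j)) (hp : fn (colimπ F) p = 0) :
    fn (lift fun a : Σ j, F.obj j => fn (c.ι.app a.1) a.2) p = 0 := by
  obtain ⟨y, hy⟩ := mem_range.1 ((cokerπ_eq_zero _ _).1 hp)
  have h : lift (colimRel F) ≫ lift (fun a : Σ j, F.obj j => fn (c.ι.app a.1) a.2) = 0 :=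
    free_ext fun y => by
      rw [fn_comp, lift_basis]
      exact lift_colimRel_comp F c y
  rw [← hy]
  exact congrArg (fun m => fn m y) h

/-- The colimit cocone is a colimit. -/
def colimCoconeIsColimit : IsColimit (colimCocone F) where
  desc c := descSurj (colimπ F) (cokerπ_surjective _) _ (colim_desc_aux F c)
  fac c j := hom_ext fun x => by
    have h := congrArg (fun m => fn m (basis ⟨j, x⟩))
      (comp_descSurj (colimπ F) (cokerπ_surjective _) _ (colim_desc_aux F c))
    refine Eq.trans h ?_
    exact lift_basis _ _
  uniq c m hm := by
    have : Epi (colimπ F) := epi_of_surjective _ (cokerπ_surjective _)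
    refine (cancel_epi (colimπ F)).1 (Eq.trans ?_ (comp_descSurj (colimπ F)
      (cokerπ_surjective _) _ (colim_desc_aux F c)).symm)
    refine free_ext fun a => ?_
    rw [lift_basis, ← hm]
    rfl

end Colimits

/-- The category of left `R`-contramodules is cocomplete. -/
instance : HasColimitsOfSize.{u, u} (ContraMod R) :=
  ⟨fun _ => ⟨fun F => ⟨⟨_, colimCoconeIsColimit F⟩⟩⟩⟩

section Projectives

variable {J : Type u} [SmallCategory J] (F : J ⥤ ContraMod R)

/-- The coproduct of free diagrams `k ↦ R[[J(j, k)]]` over all elements of all terms of `F`. -/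
def freeDiagram : J ⥤ ContraMod R where
  obj k := free R (Σ j : J, (j ⟶ k) × F.obj j)
  map f := lift fun a => basis ⟨a.1, a.2.1 ≫ f, a.2.2⟩
  map_id k := free_ext fun a => by
    rw [lift_basis, Category.comp_id]
    rfl
  map_comp f g := free_ext fun a => by
    rw [fn_comp, lift_basis, lift_basis, lift_basis, Category.assoc]

/-- Morphisms out of a free diagram. -/
def freeDiagramLift {A : J ⥤ ContraMod R} (y : ∀ j, F.obj j → A.obj j) : freeDiagram F ⟶ A where
  app k := lift fun a => fn (A.map a.2.1) (y a.1 a.2.2)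
  naturality k l f := free_ext fun a => by
    change fn (lift _) (fn (lift _) _) = fn (A.map f) (fn (lift _) _)
    rw [lift_basis, lift_basis, lift_basis, A.map_comp, fn_comp]

theorem fn_freeDiagram_map {k l : J} (f : k ⟶ l) (a : Σ j : J, (j ⟶ k) × F.obj j) :
    fn ((freeDiagram F).map f) (basis a) =
      basis (⟨a.1, a.2.1 ≫ f, a.2.2⟩ : Σ j : J, (j ⟶ l) × F.obj j) :=
  lift_basis _ _

theorem fn_freeDiagramLift {A : J ⥤ ContraMod R} (y : ∀ j, F.obj j → A.obj j) (k : J)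
    (a : Σ j : J, (j ⟶ k) × F.obj j) :
    fn ((freeDiagramLift F y).app k) (basis a) = fn (A.map a.2.1) (y a.1 a.2.2) :=
  lift_basis _ _

theorem freeDiagram_projective : Projective (freeDiagram F) where
  factors {E A} φ e he := by
    have hs : ∀ k, Function.Surjective (fn (e.app k)) := fun k => by
      have := (NatTrans.epi_iff_epi_app e).1 he k
      exact surjective_of_epi (e.app k)
    choose y hy using fun (j : J) (x : F.obj j) =>
      hs j (fn (φ.app j) (basis (⟨j, 𝟙 j, x⟩ : Σ i : J, (i ⟶ j) × F.obj i)))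
    refine ⟨freeDiagramLift F y, ?_⟩
    ext k
    refine free_ext fun a => ?_
    obtain ⟨j, g, x⟩ := a
    have h1 := congrArg (fun m => fn m (y j x)) (e.naturality g)
    have h2 := congrArg (fun m =>
      fn m (basis (⟨j, 𝟙 j, x⟩ : Σ i : J, (i ⟶ j) × F.obj i))) (φ.naturality g)
    change fn (e.app k) (fn (E.map g) _) = fn (A.map g) (fn (e.app j) _) at h1
    change fn (φ.app k) (fn ((freeDiagram F).map g) _) = fn (A.map g) (fn (φ.app j) _) at h2
    rw [fn_freeDiagram_map, Category.id_comp] at h2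
    change fn (e.app k) (fn ((freeDiagramLift F y).app k) _) = _
    rw [fn_freeDiagramLift, h1, hy]
    exact h2.symm

/-- Diagrams of contramodules have enough projectives. -/
instance : EnoughProjectives (J ⥤ ContraMod R) where
  presentation F := ⟨by
    have hs : ∀ k, Epi ((freeDiagramLift F fun _ x => x).app k) := fun k =>
      epi_of_surjective _ fun x => ⟨basis ⟨k, 𝟙 k, x⟩, by
        rw [fn_freeDiagramLift, F.map_id, fn_id]⟩
    exact
      { p := freeDiagram F
        projective := freeDiagram_projective F
        f := freeDiagramLift F fun _ x => x
        epi := NatTrans.epi_of_epi_app _ }⟩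

end Projectives

/-- A right `R`-module is discrete if each of its elements is annihilated by an open right ideal. -/
class IsDiscreteModule (R : Type u) [Ring R] [TopologicalSpace R] (N : Type u) [AddCommGroup N]
    [Module Rᵐᵒᵖ N] : Prop where
  exists_ideal : ∀ b : N, ∃ I : Submodule Rᵐᵒᵖ R, IsOpen (I : Set R) ∧
    ∀ r ∈ I, MulOpposite.op r • b = 0

section ContraTensor

variable (N : Type u) [AddCommGroup N] [Module Rᵐᵒᵖ N] (P : ContraMod R)

/-- The subgroup of `N ⊗ P` generated by all the elements
`b ⊗ π (∑ rₓ pₓ) - ∑ b rₓ ⊗ pₓ`, where the families `r` converge to zero. (For discrete `N` only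
finitely many of the `b rₓ` are nonzero.) -/
def tensorRel : AddSubgroup (N ⊗[ℤ] P) :=
  AddSubgroup.closure {z | ∃ (X : Type u) (r : FormalSum R X) (p : X → P) (b : N),
    z = b ⊗ₜ[ℤ] P.act (push p r) - ∑ᶠ x, (MulOpposite.op (r.1 x) • b) ⊗ₜ[ℤ] p x}

/-- The contratensor product of a discrete right module and a left contramodule. -/
abbrev ContraTensor : Type u := (N ⊗[ℤ] P) ⧸ tensorRel N P

variable {N} {M : Type u} [AddCommGroup M] [Module Rᵐᵒᵖ M]

theorem finite_support_smul [IsDiscreteModule R N] {X : Type u} (r : FormalSum R X) (b : N) :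
    {x | MulOpposite.op (r.1 x) • b ≠ 0}.Finite := by
  obtain ⟨I, hI, h⟩ := IsDiscreteModule.exists_ideal (R := R) b
  exact (tendsto_zero_iff.1 r.2 I hI).subset fun x hx hr => hx (h _ hr)

/-- The map of tensor products over the integers induced by a morphism of right modules. -/
def intTensorMap (f : N →ₗ[Rᵐᵒᵖ] M) : N ⊗[ℤ] P →+ M ⊗[ℤ] P :=
  (LinearMap.rTensor P f.toAddMonoidHom.toIntLinearMap).toAddMonoidHom

theorem intTensorMap_tmul (f : N →ₗ[Rᵐᵒᵖ] M) (b : N) (p : P) :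
    intTensorMap P f (b ⊗ₜ[ℤ] p) = f b ⊗ₜ[ℤ] p := rfl

/-- The map of contratensor products induced by a morphism of discrete right modules. -/
def tensorMap [IsDiscreteModule R N] (f : N →ₗ[Rᵐᵒᵖ] M) :
    ContraTensor N P →+ ContraTensor M P :=
  QuotientAddGroup.map _ _ (intTensorMap P f) (by
    refine (AddSubgroup.closure_le _).2 ?_
    rintro _ ⟨X, r, p, b, rfl⟩
    refine AddSubgroup.subset_closure ⟨X, r, p, f b, ?_⟩
    have hfin : (Function.support fun x => (MulOpposite.op (r.1 x) • b) ⊗ₜ[ℤ] p x).Finite :=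
      (finite_support_smul r b).subset fun x hx h => hx (by
        change _ ⊗ₜ[ℤ] _ = 0
        rw [h, TensorProduct.zero_tmul])
    rw [map_sub, intTensorMap_tmul]
    congr 1
    refine (AddMonoidHom.map_finsum (intTensorMap P f) hfin).trans ?_
    refine finsum_congr fun x => ?_
    rw [intTensorMap_tmul, f.map_smul])

end ContraTensor

/-- A contramodule `F` is flat if `N ↦ N ⊙ F` is an exact functor on discrete right modules. -/
def IsFlat (F : ContraMod R) : Prop :=
  ∀ (L M N : Type u) [AddCommGroup L] [AddCommGroup M] [AddCommGroup N]
    [Module Rᵐᵒᵖ L] [Module Rᵐᵒᵖ M] [Module Rᵐᵒᵖ N]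
    [IsDiscreteModule R L] [IsDiscreteModule R M] [IsDiscreteModule R N]
    (f : L →ₗ[Rᵐᵒᵖ] M) (g : M →ₗ[Rᵐᵒᵖ] N),
    Function.Injective f → Function.Exact f g → Function.Surjective g →
    Function.Injective (tensorMap F f) ∧ Function.Exact (tensorMap F f) (tensorMap F g) ∧
      Function.Surjective (tensorMap F g)

end ContraMod

end

/-! Since the contratensor product is right exact in the module argument, all that matters about
flatness is `PreservesInjections`. Colimits are right exact, so part (1) amounts to injectivity of
the colimit of the first maps. Contratensor products commute with colimits, and filtered colimits of
abelian groups are exact, so injectivity after applying `N ⊙ -` (`UniversallyInjective`) passes to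
filtered colimits without difficulty. What remains is to return from universal injectivity to
injectivity.

This is `UniversallyInjective.injective`: a universally injective `h : A ⟶ B` is injective when `B`
preserves injections. Cover `A` by a free contramodule `p : R[[X]] ⟶ A` and let `h (p g) = 0`. For
open right ideals `I` and `I'` with the coefficients of `g` in `I`, tensoring with the image of `I`
in `R/I'` shows that, modulo `I'`, `g` is a sum of elements of `ker p` with weights in `I`
(`exists_kerSum_approx`). Along a countable base of ideals the corrections have weights tending to
zero, so they combine into one infinite combination of elements of `ker p` equal to `g`
(`exists_eq_kerSum`), and `p g = 0`. Countability of the base makes this sequential construction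
possible.

The same approximation with `h = 𝟙` gives a substitute for the vanishing of the first Tor: the
kernel of a free cover of a flat contramodule is universally injective, first for `N = R/J`, then
for every discrete `N` (`universallyInjective_kerι`). A pullback-pushout square carries this over to
every short exact sequence with flat third term.

For a short exact sequence of diagrams, the middle term is replaced by a projective cover, whose
terms are retracts of free contramodules, so that the injectivity criterion applies to its colimit;
the same square then descends to the original sequence (`mono_colim_map`). Part (2) follows by
dimension shifting, as flat diagrams contain the projectives and are closed under kernels of
epimorphisms (`isZero_leftDerived_obj_of_class`). -/

/-! ### Null families: supplements on coefficients and double families -/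

namespace FormalSum

variable {R : Type u} [Ring R] [UniformSpace R] [IsUniformAddGroup R] [IsTopologicalRing R]
  [CompleteSpace R] [T0Space R] [IsLinearTopology Rᵐᵒᵖ R]
  {X : Type*} {Y : Type*}

theorem mem_iff {a : X → R} : a ∈ nullFamilies R X ↔ Filter.Tendsto a Filter.cofinite (𝓝 0) :=
  Iff.rfl

open Classical in
theorem push_apply (f : X → Y) (a : FormalSum R X) (y : Y) :
    (push f a).1 y = ∑' x, a.1 x * (point (f x) : FormalSum R Y).1 y := by
  rw [← pair_single, pair_push]
  refine tsum_congr fun x => ?_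
  rw [← pair_single (point (f x)), pair_point]

theorem point_self (x : X) : (point x : FormalSum R X).1 x = 1 := by
  classical
  rw [← pair_single, pair_point, Pi.single_eq_same]

theorem point_of_ne {x y : X} (h : y ≠ x) : (point x : FormalSum R X).1 y = 0 := by
  classical
  rw [← pair_single, pair_point, Pi.single_eq_of_ne' h]

theorem finite_notMem (a : FormalSum R X) {I : Submodule Rᵐᵒᵖ R} (hI : IsOpen (I : Set R)) :
    {x | a.1 x ∉ I}.Finite := tendsto_zero_iff.1 a.2 I hI

/-- All but finitely many `s t` lie in a given open right ideal, which absorbs multiplication on the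
right. For each remaining `t`, continuity of left multiplication by `s t` leaves finitely many bad
`x`. -/
theorem tendsto_mul_family (s : FormalSum R Y) (m : Y → FormalSum R X) :
    Filter.Tendsto (fun p : Y × X => s.1 p.1 * (m p.1).1 p.2) Filter.cofinite (𝓝 0) := by
  rw [tendsto_zero_iff]
  intro I hI
  choose J hJ hJI using fun t : Y => exists_mul_mem I hI (s.1 t)
  refine ((finite_notMem s hI).biUnion fun t _ =>
    ((finite_notMem (m t) (hJ t)).image (Prod.mk t))).subset ?_
  rintro ⟨t, x⟩ h
  simp only [Set.mem_iUnion]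
  exact ⟨t, fun ht => h (mul_mem_of_mem ht _), x, fun hx => h (hJI t _ hx), rfl⟩

/-- The finite formal linear combination with the given coefficients. -/
noncomputable def ofFinite (a : X → R) (h : a.support.Finite) : FormalSum R X :=
  ⟨a, tendsto_nhds_of_eventually_eq (Filter.eventually_cofinite.2 h)⟩

end FormalSum

noncomputable section

namespace ContraMod

open FormalSum

variable {R : Type u} [Ring R] [UniformSpace R] [IsUniformAddGroup R] [IsTopologicalRing R]
  [CompleteSpace R] [T0Space R] [IsLinearTopology Rᵐᵒᵖ R]

/-! ### Discrete modules and the contramodule of additive maps out of them -/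

section Discrete

variable {N : Type u} [AddCommGroup N] [Module Rᵐᵒᵖ N] [IsDiscreteModule R N]

theorem finite_support_op_smul {ι : Type*} {a : ι → R}
    (ha : Filter.Tendsto a Filter.cofinite (𝓝 0)) (b : N) :
    (Function.support fun i => MulOpposite.op (a i) • b).Finite := by
  obtain ⟨I, hI, h⟩ := IsDiscreteModule.exists_ideal (R := R) b
  exact (tendsto_zero_iff.1 ha I hI).subset fun x hx hr => hx (h _ hr)

/-- An open right ideal annihilating `b` contains all but finitely many terms and, being closed,
also the sum of those terms. -/
theorem op_tsum_smul {ι : Type*} {a : ι → R} (ha : Filter.Tendsto a Filter.cofinite (𝓝 0))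
    (b : N) : MulOpposite.op (∑' i, a i) • b = ∑ᶠ i, MulOpposite.op (a i) • b := by
  obtain ⟨I, hI, h⟩ := IsDiscreteModule.exists_ideal (R := R) b
  have hF := tendsto_zero_iff.1 ha I hI
  have hs := summable_of_tendsto ha
  rw [finsum_eq_sum_of_support_subset (s := hF.toFinset) _ (fun x hx => by
    simp only [Set.Finite.coe_toFinset]
    exact fun hr => hx (h _ hr))]
  rw [← hs.sum_add_tsum_subtype_compl hF.toFinset, MulOpposite.op_add, add_smul,
    h _ (tsum_mem_ideal hI fun x => by simpa using x.2), add_zero]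
  rw [Finset.op_sum, Finset.sum_smul]

variable {V : Type u} [AddCommGroup V] {X : Type u} {Y : Type u}

theorem finite_support_map_op_smul {ι : Type*} {a : ι → R}
    (ha : Filter.Tendsto a Filter.cofinite (𝓝 0)) (φ : ι → N →+ V) (b : N) :
    (Function.support fun i => φ i (MulOpposite.op (a i) • b)).Finite :=
  (finite_support_op_smul ha b).subset fun x hx h => hx ((congrArg (φ x) h).trans (map_zero _))

/-- The pairing `b ↦ ∑ φₓ (b aₓ)` of a formal linear combination with additive maps out of a
discrete module. -/
def dpair (a : FormalSum R X) (φ : X → N →+ V) : N →+ V :=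
  AddMonoidHom.mk' (fun b => ∑ᶠ x, φ x (MulOpposite.op (a.1 x) • b)) fun b c => by
    simp only [smul_add, map_add]
    exact finsum_add_distrib (finite_support_map_op_smul a.2 φ b)
      (finite_support_map_op_smul a.2 φ c)

theorem dpair_apply (a : FormalSum R X) (φ : X → N →+ V) (b : N) :
    dpair a φ b = ∑ᶠ x, φ x (MulOpposite.op (a.1 x) • b) := rfl

theorem dpair_point (x : X) (φ : X → N →+ V) : dpair (point x : FormalSum R X) φ = φ x := by
  ext b
  rw [dpair_apply, finsum_eq_single _ x, point_self, MulOpposite.op_one, one_smul]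
  intro y hy
  rw [point_of_ne hy, MulOpposite.op_zero, zero_smul, map_zero]

/-- Exchange of two finite sums. It specialises both to `push` and to `join`, which is what
contraassociativity of `homContra` needs. -/
theorem dpair_eq_dpair (s : FormalSum R Y) (m : Y → FormalSum R X) (c : FormalSum R X)
    (hc : ∀ x, c.1 x = ∑' t, s.1 t * (m t).1 x) (φ : X → N →+ V) :
    dpair c φ = dpair s fun t => dpair (m t) φ := by
  ext b
  have hn := tendsto_mul_family s m
  let f : Y × X → V := fun p => φ p.2 (MulOpposite.op (s.1 p.1 * (m p.1).1 p.2) • b)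
  have hf : f.support.Finite := finite_support_map_op_smul hn (fun p => φ p.2) b
  have hf' : (fun p : X × Y => f (p.2, p.1)).support.Finite :=
    (hf.image Prod.swap).subset fun p hp => ⟨(p.2, p.1), hp, rfl⟩
  have h1 : dpair c φ b = ∑ᶠ (x) (t), f (t, x) := by
    rw [dpair_apply]
    refine finsum_congr fun x => ?_
    have hx : Filter.Tendsto (fun t => s.1 t * (m t).1 x) Filter.cofinite (𝓝 0) :=
      hn.comp (Function.Injective.tendsto_cofinite (f := fun t => (t, x))
        fun a b h => congrArg Prod.fst h)
    rw [hc, op_tsum_smul hx]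
    exact (φ x).map_finsum (finite_support_op_smul hx b)
  have h2 : dpair s (fun t => dpair (m t) φ) b = ∑ᶠ (t) (x), f (t, x) := by
    rw [dpair_apply]
    refine finsum_congr fun t => ?_
    rw [dpair_apply]
    refine finsum_congr fun x => ?_
    simp only [f, MulOpposite.op_mul, mul_smul]
  rw [h1, h2, ← finsum_curry _ hf, ← finsum_curry (fun p : X × Y => f (p.2, p.1)) hf']
  exact finsum_comp_equiv (Equiv.prodComm X Y) (f := f)

theorem dpair_push (f : Y → X) (s : FormalSum R Y) (φ : X → N →+ V) :
    dpair (push f s) φ = dpair s fun t => φ (f t) := by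
  rw [dpair_eq_dpair s (fun t => point (f t)) _ (fun x => by classical exact push_apply f s x)]
  simp only [dpair_point]

theorem dpair_join (s : FormalSum R (FormalSum R X)) (φ : X → N →+ V) :
    dpair (join s) φ = dpair s fun t => dpair t φ :=
  dpair_eq_dpair s (fun t => t) _ (fun _ => rfl) φ

theorem comp_dpair {W : Type u} [AddCommGroup W] (g : V →+ W) (a : FormalSum R X)
    (φ : X → N →+ V) : g.comp (dpair a φ) = dpair a fun x => g.comp (φ x) := by
  ext b
  exact g.map_finsum (finite_support_map_op_smul a.2 φ b)

theorem dpair_add (a c : FormalSum R X) (φ : X → N →+ V) :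
    dpair (a + c) φ = dpair a φ + dpair c φ := by
  ext b
  refine Eq.trans ?_ (finsum_add_distrib (finite_support_map_op_smul a.2 φ b)
      (finite_support_map_op_smul c.2 φ b))
  refine finsum_congr fun x => ?_
  rw [← map_add, ← add_smul, ← MulOpposite.op_add]
  rfl

variable (R N V) in
/-- The contramodule of additive maps from a discrete right module to an abelian group. -/
def homContra : ContraMod R where
  carrier := N →+ V
  str :=
    { act := fun s => dpair s fun φ => φ
      act_point := fun φ => dpair_point φ _
      act_join := fun s => by rw [dpair_join, dpair_push] }

/-- The additive map underlying an element of the contramodule of additive maps. -/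
def homContraEval : homContra R N V →+ N →+ V :=
  AddMonoidHom.mk' (fun φ => φ) fun φ ψ => by
    -- The sum in `homContra` is defined through the contraaction on `point φ + point ψ`, so its
    -- agreement with pointwise addition has to be checked.
    refine (dpair_add (X := N →+ V) (point φ) (point ψ) fun φ => φ).trans ?_
    exact congrArg₂ (· + ·) (dpair_point (X := N →+ V) φ _) (dpair_point (X := N →+ V) ψ _)

theorem homContraEval_injective :
    Function.Injective (homContraEval : homContra R N V →+ N →+ V) := fun _ _ h => h

theorem homContraEval_act_push {X : Type u} (f : X → homContra R N V) (s : FormalSum R X) :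
    homContraEval ((homContra R N V).act (push f s)) = dpair s fun x => homContraEval (f x) :=
  dpair_push f s _

end Discrete

/-! ### The contratensor product: adjunction and right exactness in each argument -/

section Tensor

variable {N : Type u} [AddCommGroup N] [Module Rᵐᵒᵖ N]
  {M : Type u} [AddCommGroup M] [Module Rᵐᵒᵖ M] {L : Type u} [AddCommGroup L] [Module Rᵐᵒᵖ L]
  {P Q T : ContraMod R} {V : Type u} [AddCommGroup V]

/-- The class of a pure tensor in the contratensor product. -/
def tmul (b : N) (p : P) : ContraTensor N P := QuotientAddGroup.mk (b ⊗ₜ[ℤ] p)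

theorem tmul_add (b : N) (p q : P) : tmul b (p + q) = tmul b p + tmul b q :=
  congrArg QuotientAddGroup.mk (TensorProduct.tmul_add b p q)

theorem add_tmul (b c : N) (p : P) : tmul (b + c) p = tmul b p + tmul c p :=
  congrArg QuotientAddGroup.mk (TensorProduct.add_tmul b c p)

variable (P) in
/-- The pure tensor as an additive function of the left factor. -/
def tmulHom (N : Type u) [AddCommGroup N] [Module Rᵐᵒᵖ N] (p : P) : N →+ ContraTensor N P :=
  AddMonoidHom.mk' (fun b => tmul b p) fun b c => add_tmul b c p

/-- The pure tensor as an additive function of the right factor. -/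
def tmulHom' (b : N) : P →+ ContraTensor N P :=
  AddMonoidHom.mk' (fun p => tmul b p) fun p q => tmul_add b p q

theorem tmul_zero (b : N) : tmul b (0 : P) = 0 := (tmulHom' b).map_zero
theorem zero_tmul (p : P) : tmul (0 : N) p = 0 := (tmulHom P N p).map_zero

@[elab_as_elim]
theorem contraTensor_induction {C : ContraTensor N P → Prop} (z : ContraTensor N P)
    (h0 : C 0) (ht : ∀ b p, C (tmul b p)) (ha : ∀ x y, C x → C y → C (x + y)) : C z := by
  obtain ⟨z, rfl⟩ := QuotientAddGroup.mk_surjective z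
  induction z using TensorProduct.induction_on with
  | zero => exact h0
  | tmul b p => exact ht b p
  | add x y hx hy => exact ha _ _ hx hy

theorem contraTensor_hom_ext {f g : ContraTensor N P →+ V}
    (h : ∀ b p, f (tmul b p) = g (tmul b p)) : f = g := by
  refine AddMonoidHom.ext fun z => ?_
  induction z using contraTensor_induction with
  | h0 => rw [map_zero, map_zero]
  | ht b p => exact h b p
  | ha x y hx hy => rw [map_add, map_add, hx, hy]

section

variable [IsDiscreteModule R N]

theorem tmul_act_push {X : Type u} (b : N) (r : FormalSum R X) (p : X → P) :
    tmul b (P.act (push p r)) = ∑ᶠ x, tmul (MulOpposite.op (r.1 x) • b) (p x) := by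
  have h : (QuotientAddGroup.mk (b ⊗ₜ[ℤ] P.act (push p r)) : ContraTensor N P) =
      QuotientAddGroup.mk (∑ᶠ x, (MulOpposite.op (r.1 x) • b) ⊗ₜ[ℤ] p x) := by
    rw [eq_comm, QuotientAddGroup.eq, neg_add_eq_sub]
    exact AddSubgroup.subset_closure ⟨X, r, p, b, rfl⟩
  refine h.trans ?_
  refine (QuotientAddGroup.mk' (tensorRel N P)).map_finsum ?_
  exact (finite_support_smul r b).subset fun x hx h => hx (by
    change _ ⊗ₜ[ℤ] _ = 0
    rw [h, TensorProduct.zero_tmul])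

theorem int_smul_comm_hom (f : P →+ N →+ V) (n : ℤ) (b : N) (p : P) :
    f p (n • b) = f (n • p) b := by
  rw [map_zsmul, map_zsmul]
  rfl

/-- The additive map out of a contratensor product given by a morphism to the contramodule of
additive maps. -/
def tensorLift (f : P ⟶ homContra R N V) : ContraTensor N P →+ V :=
  QuotientAddGroup.lift (tensorRel N P)
    (TensorProduct.liftAddHom (homContraEval.comp (addHom f)).flip fun n b p => by
      exact int_smul_comm_hom (homContraEval.comp (addHom f)) n b p) (by
    refine (AddSubgroup.closure_le _).2 ?_
    rintro _ ⟨X, r, p, b, rfl⟩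
    have hfin : (Function.support fun x => (MulOpposite.op (r.1 x) • b) ⊗ₜ[ℤ] p x).Finite :=
      (finite_support_smul r b).subset fun x hx h => hx (by
        change _ ⊗ₜ[ℤ] _ = 0
        rw [h, TensorProduct.zero_tmul])
    change TensorProduct.liftAddHom _ _ _ = 0
    rw [map_sub, sub_eq_zero, AddMonoidHom.map_finsum _ hfin]
    change homContraEval (fn f (P.act (push p r))) b = _
    rw [fn_act, push_push, homContraEval_act_push]
    rfl)

/-- The morphism to the contramodule of additive maps given by an additive map out of the
contratensor product. -/
def tensorCurry (g : ContraTensor N P →+ V) : P ⟶ homContra R N V :=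
  mkHom (fun p => g.comp (tmulHom P N p)) fun s => by
    refine Eq.trans ?_ (homContraEval_act_push _ s).symm
    change _ = dpair s fun p => g.comp (tmulHom P N p)
    rw [← comp_dpair]
    congr 1
    ext b
    change tmul b (P.act s) = _
    conv_lhs => rw [← push_id s, tmul_act_push]
    rfl

variable (N) in
/-- The map of contratensor products induced by a morphism of contramodules. -/
def mapRight (f : P ⟶ Q) : ContraTensor N P →+ ContraTensor N Q :=
  tensorLift (f ≫ tensorCurry (AddMonoidHom.id _))

theorem mapRight_tmul (f : P ⟶ Q) (b : N) (p : P) :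
    mapRight N f (tmul b p) = tmul b (fn f p) := rfl

theorem mapRight_id (P : ContraMod R) : mapRight N (𝟙 P) = AddMonoidHom.id _ :=
  contraTensor_hom_ext fun _ _ => rfl

theorem mapRight_comp (f : P ⟶ Q) (g : Q ⟶ T) :
    mapRight N (f ≫ g) = (mapRight N g).comp (mapRight N f) :=
  contraTensor_hom_ext fun _ _ => rfl

theorem mapRight_comp_apply (f : P ⟶ Q) (g : Q ⟶ T) (z : ContraTensor N P) :
    mapRight N (f ≫ g) z = mapRight N g (mapRight N f z) :=
  DFunLike.congr_fun (mapRight_comp f g) z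

variable (R N) in
/-- The contratensor product functor. -/
def tensorFunctor : ContraMod R ⥤ AddCommGrpCat.{u} where
  obj P := AddCommGrpCat.of (ContraTensor N P)
  map f := AddCommGrpCat.ofHom (mapRight N f)
  map_id P := by rw [mapRight_id]; rfl
  map_comp f g := by rw [mapRight_comp]; rfl

variable (R N) in
/-- The contramodule of additive maps as a functor. -/
def homFunctor : AddCommGrpCat.{u} ⥤ ContraMod R where
  obj V := homContra R N V
  map g := mkHom (fun φ => g.hom.comp (homContraEval φ)) fun s =>
    (comp_dpair g.hom s _).trans (homContraEval_act_push _ s).symm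
  map_id _ := rfl
  map_comp _ _ := rfl

variable (R N) in
/-- The contratensor product is left adjoint to the contramodule of additive maps. -/
def tensorAdjunction : tensorFunctor R N ⊣ homFunctor R N :=
  Adjunction.mkOfHomEquiv
    { homEquiv := fun _ _ =>
        { toFun := fun g => tensorCurry g.hom
          invFun := fun f => AddCommGrpCat.ofHom (tensorLift f)
          left_inv := fun _ => AddCommGrpCat.hom_ext (contraTensor_hom_ext fun _ _ => rfl)
          right_inv := fun _ => rfl }
      homEquiv_naturality_left_symm := fun _ _ =>
        AddCommGrpCat.hom_ext (contraTensor_hom_ext fun _ _ => rfl)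
      homEquiv_naturality_right := fun _ _ => rfl }

instance : (tensorFunctor R N).IsLeftAdjoint := (tensorAdjunction R N).isLeftAdjoint

/-- Right exactness of the contratensor product in the contramodule argument. -/
theorem exists_of_mapRight_eq_zero (f : P ⟶ Q) (hf : Function.Surjective (fn f))
    (z : ContraTensor N P) (hz : mapRight N f z = 0) :
    ∃ y, mapRight N (kerι f) y = z := by
  -- The projection modulo the image of `N ⊙ ker f`, transposed by the adjunction, kills `ker f` and
  -- hence factors through `Q`. So it factors through `mapRight N f`, and anything killed by the
  -- latter lies in that image.
  let π := QuotientAddGroup.mk' (mapRight N (kerι f)).range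
  have hπ : ∀ p, fn f p = 0 → fn (tensorCurry π) p = 0 := fun p hp => by
    refine homContraEval_injective ?_
    rw [map_zero]
    refine AddMonoidHom.ext (M := N) (N := _ ⧸ (mapRight N (kerι f)).range) fun b => ?_
    have h : tmul b p ∈ (mapRight N (kerι f)).range :=
      ⟨tmul b (⟨p, hp⟩ : {p | fn f p = 0}), rfl⟩
    exact (QuotientAddGroup.eq_zero_iff _).2 h
  have h : (tensorLift (descSurj f hf (tensorCurry π) hπ)).comp (mapRight N f) = π :=
    contraTensor_hom_ext fun b p =>
      congrArg (fun m => homContraEval (fn m p) b) (comp_descSurj f hf (tensorCurry π) hπ)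
  have h' : π z = 0 := by
    rw [← h, AddMonoidHom.comp_apply, hz, map_zero]
  exact (QuotientAddGroup.eq_zero_iff z).1 h'

variable [IsDiscreteModule R M]

theorem tensorMap_tmul (P : ContraMod R) (f : N →ₗ[Rᵐᵒᵖ] M) (b : N) (p : P) :
    tensorMap P f (tmul b p) = tmul (f b) p := rfl

theorem tensorMap_mapRight (f : N →ₗ[Rᵐᵒᵖ] M) (g : P ⟶ Q) (z : ContraTensor N P) :
    tensorMap Q f (mapRight N g z) = mapRight M g (tensorMap P f z) := by
  have h : (tensorMap Q f).comp (mapRight N g) = (mapRight M g).comp (tensorMap P f) :=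
    contraTensor_hom_ext fun _ _ => rfl
  exact DFunLike.congr_fun h z

theorem tensorMap_surjective (P : ContraMod R) (f : N →ₗ[Rᵐᵒᵖ] M) (hf : Function.Surjective f) :
    Function.Surjective (tensorMap P f) := fun z => by
  induction z using contraTensor_induction with
  | h0 => exact ⟨0, map_zero _⟩
  | ht b p =>
    obtain ⟨q, rfl⟩ := hf b
    exact ⟨tmul q p, rfl⟩
  | ha x y hx hy =>
    obtain ⟨x, rfl⟩ := hx
    obtain ⟨y, rfl⟩ := hy
    exact ⟨x + y, map_add _ _ _⟩

/-- A generating relation lifts as soon as its module element does. This lets exactness descend from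
the tensor product over the integers to its quotient. -/
theorem mem_tensorRel_of_surjective (f : N →ₗ[Rᵐᵒᵖ] M) (hf : Function.Surjective f)
    (z : M ⊗[ℤ] P) (hz : z ∈ tensorRel M P) :
    ∃ y ∈ tensorRel N P, intTensorMap P f y = z := by
  suffices h : tensorRel M P ≤ (tensorRel N P).map (intTensorMap P f) from h hz
  refine (AddSubgroup.closure_le _).2 ?_
  rintro _ ⟨X, r, p, c, rfl⟩
  obtain ⟨b, rfl⟩ := hf c
  refine ⟨_, AddSubgroup.subset_closure ⟨X, r, p, b, rfl⟩, ?_⟩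
  have hfin : (Function.support fun x => (MulOpposite.op (r.1 x) • b) ⊗ₜ[ℤ] p x).Finite :=
    (finite_support_smul r b).subset fun x hx h => hx (by
      change _ ⊗ₜ[ℤ] _ = 0
      rw [h, TensorProduct.zero_tmul])
  rw [map_sub, intTensorMap_tmul]
  congr 1
  refine (AddMonoidHom.map_finsum (intTensorMap P f) hfin).trans ?_
  refine finsum_congr fun x => ?_
  rw [intTensorMap_tmul, f.map_smul]

/-- Right exactness of the contratensor product in the module argument. -/
theorem tensorMap_exact [IsDiscreteModule R L] (P : ContraMod R) (f : L →ₗ[Rᵐᵒᵖ] N)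
    (g : N →ₗ[Rᵐᵒᵖ] M) (hfg : Function.Exact f g) (hg : Function.Surjective g) :
    Function.Exact (tensorMap P f) (tensorMap P g) := fun z => by
  constructor
  · intro hz
    obtain ⟨z, rfl⟩ := QuotientAddGroup.mk_surjective z
    have hz' : intTensorMap P g z ∈ tensorRel M P := (QuotientAddGroup.eq_zero_iff _).1 hz
    obtain ⟨y, hy, hyz⟩ := mem_tensorRel_of_surjective g hg _ hz'
    have hex : Function.Exact f.toAddMonoidHom.toIntLinearMap g.toAddMonoidHom.toIntLinearMap :=
      hfg
    have h := rTensor_exact (Q := P) hex hg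
    obtain ⟨x, hx⟩ := (h (z - y)).1 (by
      refine (map_sub (intTensorMap P g) z y).trans ?_
      rw [hyz, sub_self])
    refine ⟨QuotientAddGroup.mk x, ?_⟩
    change QuotientAddGroup.mk (intTensorMap P f x) = _
    have hx' : intTensorMap P f x = z - y := hx
    rw [hx', QuotientAddGroup.eq]
    simpa using hy
  · rintro ⟨y, rfl⟩
    have h : (tensorMap P g).comp (tensorMap P f) = 0 := contraTensor_hom_ext fun b p => by
      change tmul (g (f b)) p = 0
      rw [hfg.apply_apply_eq_zero, zero_tmul]
    exact DFunLike.congr_fun h y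

end

end Tensor

end ContraMod

end

noncomputable section

namespace ContraMod

open FormalSum

variable {R : Type u} [Ring R] [UniformSpace R] [IsUniformAddGroup R] [IsTopologicalRing R]
  [CompleteSpace R] [T0Space R] [IsLinearTopology Rᵐᵒᵖ R]

/-! ### Contratensor product with a free contramodule as a direct sum of copies of `N` -/

section FreeTensor

variable {N : Type u} [AddCommGroup N] [Module Rᵐᵒᵖ N] [IsDiscreteModule R N]
  {M : Type u} [AddCommGroup M] [Module Rᵐᵒᵖ M] [IsDiscreteModule R M] {X : Type u}

/-- The formal linear combination underlying an element of a free contramodule. -/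
def coeffs (g : free R X) : FormalSum R X := g

theorem coeffs_add (g k : free R X) : coeffs (g + k) = coeffs g + coeffs k := by
  refine (join_add (point (coeffs g)) (point (coeffs k))).trans ?_
  rw [join_point, join_point]

theorem coeffs_sub (g k : free R X) : coeffs (g - k) = coeffs g - coeffs k :=
  (AddMonoidHom.mk' coeffs coeffs_add).map_sub g k

theorem coeffs_sub_apply (g k : free R X) (x : X) :
    (coeffs (g - k)).1 x = (coeffs g).1 x - (coeffs k).1 x := by
  rw [coeffs_sub]
  rfl

theorem act_push_basis (g : free R X) : (free R X).act (push basis (coeffs g)) = g :=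
  join_push_point (coeffs g)

open Classical in
/-- The coefficients of an element of the contratensor product with a free contramodule. -/
def coeff : ContraTensor N (free R X) →+ X → N :=
  tensorLift (lift fun x => (AddMonoidHom.single (fun _ : X => N) x : homContra R N (X → N)))

theorem coeff_tmul (b : N) (g : free R X) (x : X) :
    coeff (tmul b g) x = MulOpposite.op ((coeffs g).1 x) • b := by
  classical
  have h : coeff (tmul b g) =
      dpair (coeffs g) (fun x => AddMonoidHom.single (fun _ : X => N) x) b := by
    refine Eq.trans ?_ (DFunLike.congr_fun (homContraEval_act_push
      (fun x => (AddMonoidHom.single (fun _ : X => N) x : homContra R N (X → N)))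
      (coeffs g)) b)
    rfl
  rw [h, dpair_apply]
  have hf := finite_support_map_op_smul (g : FormalSum R X).2
    (fun x => AddMonoidHom.single (fun _ : X => N) x) b
  refine ((Pi.evalAddMonoidHom (fun _ : X => N) x).map_finsum hf).trans ?_
  rw [finsum_eq_single _ x]
  · simp only [AddMonoidHom.single_apply, Pi.evalAddMonoidHom_apply, Pi.single_eq_same]
    rfl
  · intro y hy
    simp [Pi.single_eq_of_ne' hy]

theorem coeff_tensorMap (f : N →ₗ[Rᵐᵒᵖ] M) (z : ContraTensor N (free R X)) (x : X) :
    coeff (tensorMap _ f z) x = f (coeff z x) := by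
  induction z using contraTensor_induction with
  | h0 => simp
  | ht b g => rw [tensorMap_tmul, coeff_tmul, coeff_tmul, f.map_smul]
  | ha y z hy hz => simp only [map_add, Pi.add_apply, hy, hz]

/-- With `exists_coeff_eq`, this identifies `N ⊙ R[[X]]` with the finitely supported functions `X →
N`: contraassociativity spreads `b ⊗ g` over the basis, and discreteness leaves finitely many terms.
-/
theorem coeff_spec (z : ContraTensor N (free R X)) :
    (coeff z).support.Finite ∧ z = ∑ᶠ x, tmul (coeff z x) (basis x : free R X) := by
  induction z using contraTensor_induction with
  | h0 => simp [zero_tmul]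
  | ht b g =>
    have h : coeff (tmul b g) = fun x => MulOpposite.op ((coeffs g).1 x) • b :=
      funext fun x => coeff_tmul b g x
    rw [h]
    refine ⟨finite_support_smul (coeffs g) b, ?_⟩
    conv_lhs => rw [← act_push_basis g]
    exact tmul_act_push b (coeffs g) basis
  | ha y z hy hz =>
    refine ⟨?_, ?_⟩
    · rw [map_add]
      exact (hy.1.union hz.1).subset (Function.support_add _ _)
    · conv_lhs => rw [hy.2, hz.2]
      rw [← finsum_add_distrib]
      · simp only [map_add, Pi.add_apply, add_tmul]
      · exact hy.1.subset fun x hx h => hx (by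
          change tmul (coeff y x) _ = _
          rw [h, zero_tmul])
      · exact hz.1.subset fun x hx h => hx (by
          change tmul (coeff z x) _ = _
          rw [h, zero_tmul])

theorem coeff_injective : Function.Injective (coeff : ContraTensor N (free R X) → X → N) := by
  refine (injective_iff_map_eq_zero coeff).2 fun z hz => ?_
  rw [(coeff_spec z).2, hz]
  simp [zero_tmul]

theorem exists_coeff_eq (c : X → N) (hc : c.support.Finite) :
    ∃ z : ContraTensor N (free R X), coeff z = c := by
  classical
  refine ⟨∑ᶠ x, tmul (c x) (basis x : free R X), ?_⟩
  rw [AddMonoidHom.map_finsum]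
  · funext y
    refine ((Pi.evalAddMonoidHom (fun _ : X => N) y).map_finsum ?_).trans ?_
    · refine hc.subset fun x hx h => hx ?_
      change coeff (tmul (c x) _) = _
      rw [h, zero_tmul, map_zero]
    · rw [finsum_eq_single _ y]
      · change coeff (tmul _ _) y = _
        rw [coeff_tmul]
        change MulOpposite.op ((point y : FormalSum R X).1 y) • _ = _
        rw [point_self, MulOpposite.op_one, one_smul]
      · intro x hx
        change coeff (tmul _ _) y = _
        rw [coeff_tmul]
        change MulOpposite.op ((point x : FormalSum R X).1 y) • _ = _
        rw [point_of_ne hx.symm, MulOpposite.op_zero, zero_smul]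
  · refine hc.subset fun x hx h => hx ?_
    change tmul (c x) _ = _
    rw [h, zero_tmul]

end FreeTensor

/-! ### The two working notions: preserving injections and universal injectivity -/

/-- Tensoring with `F` preserves injectivity of morphisms of discrete modules. -/
def PreservesInjections (F : ContraMod R) : Prop :=
  ∀ (L M : Type u) [AddCommGroup L] [AddCommGroup M] [Module Rᵐᵒᵖ L] [Module Rᵐᵒᵖ M]
    [IsDiscreteModule R L] [IsDiscreteModule R M] (f : L →ₗ[Rᵐᵒᵖ] M),
    Function.Injective f → Function.Injective (tensorMap F f)

/-- Tensoring with any discrete module keeps `h` injective. -/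
def UniversallyInjective {A B : ContraMod R} (h : A ⟶ B) : Prop :=
  ∀ (N : Type u) [AddCommGroup N] [Module Rᵐᵒᵖ N] [IsDiscreteModule R N],
    Function.Injective (mapRight N h)

instance quotient_isDiscrete {M : Type u} [AddCommGroup M] [Module Rᵐᵒᵖ M] [IsDiscreteModule R M]
    (S : Submodule Rᵐᵒᵖ M) : IsDiscreteModule R (M ⧸ S) where
  exists_ideal b := by
    obtain ⟨b, rfl⟩ := S.mkQ_surjective b
    obtain ⟨I, hI, h⟩ := IsDiscreteModule.exists_ideal (R := R) b
    exact ⟨I, hI, fun r hr => by rw [← map_smul, h r hr, map_zero]⟩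

instance submodule_isDiscrete {M : Type u} [AddCommGroup M] [Module Rᵐᵒᵖ M] [IsDiscreteModule R M]
    (S : Submodule Rᵐᵒᵖ M) : IsDiscreteModule R S where
  exists_ideal b := by
    obtain ⟨I, hI, h⟩ := IsDiscreteModule.exists_ideal (R := R) b.1
    exact ⟨I, hI, fun r hr => Subtype.ext (h r hr)⟩

/-- The annihilator of the class of `b` consists of the `r` with `b * r ∈ I`; it contains an open
right ideal because left multiplication by `b` is continuous. -/
theorem quotient_isDiscrete_of_isOpen (I : Submodule Rᵐᵒᵖ R) (hI : IsOpen (I : Set R)) :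
    IsDiscreteModule R (R ⧸ I) where
  exists_ideal b := by
    obtain ⟨b, rfl⟩ := I.mkQ_surjective b
    obtain ⟨I', hI', h⟩ := exists_mul_mem I hI b
    refine ⟨I', hI', fun r hr => ?_⟩
    rw [← map_smul]
    exact (Submodule.Quotient.mk_eq_zero I).2 (h r hr)

theorem IsFlat.preservesInjections {F : ContraMod R} (hF : IsFlat F) : PreservesInjections F :=
  fun L M _ _ _ _ _ _ f hf => (hF L M (M ⧸ LinearMap.range f) f (LinearMap.range f).mkQ hf
    (LinearMap.exact_iff.2 (Submodule.ker_mkQ _)) (Submodule.mkQ_surjective _)).1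

theorem preservesInjections_free (X : Type u) : PreservesInjections (free R X) :=
  fun L M _ _ _ _ _ _ f hf => by
    refine (injective_iff_map_eq_zero _).2 fun z hz => coeff_injective (funext fun x => hf ?_)
    rw [← coeff_tensorMap, hz, map_zero, map_zero, Pi.zero_apply, Pi.zero_apply, map_zero]

/-! ### Successive approximation by combinations of kernel elements -/

/-- The class of `r ∈ I` in `R ⧸ I'` is `1 · r`, and `r` can be moved across the tensor sign as the
weight of a one-term formal sum. -/
theorem exists_tmul_one (K : ContraMod R) (I I' : Submodule Rᵐᵒᵖ R)
    [IsDiscreteModule R (R ⧸ I')] (t : ContraTensor (I.map I'.mkQ) K) :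
    ∃ σ : FormalSum R K, (∀ k, σ.1 k ∈ I) ∧
      tensorMap K (I.map I'.mkQ).subtype t = tmul (I'.mkQ 1) (K.act σ) := by
  classical
  induction t using contraTensor_induction with
  | h0 => exact ⟨0, fun _ => I.zero_mem, by rw [map_zero, act_zero, tmul_zero]⟩
  | ht b k =>
    obtain ⟨_, r, hr, rfl⟩ := b
    refine ⟨ofFinite (Pi.single k r) ((Set.finite_singleton k).subset
      (Pi.support_single_subset)), fun k' => ?_, ?_⟩
    · by_cases h : k' = k
      · subst h
        simpa [ofFinite] using hr
      · simp [ofFinite, Pi.single_eq_of_ne h]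
    · rw [tensorMap_tmul]
      conv_rhs => rw [← push_id (ofFinite _ _), tmul_act_push]
      rw [finsum_eq_single _ k]
      · simp only [ofFinite, Pi.single_eq_same]
        rw [← map_smul]
        simp
      · intro k' h
        simp [ofFinite, Pi.single_eq_of_ne h, zero_tmul]
  | ha x y hx hy =>
    obtain ⟨σ, hσ, h⟩ := hx
    obtain ⟨τ, hτ, h'⟩ := hy
    exact ⟨σ + τ, fun k => I.add_mem (hσ k) (hτ k), by rw [map_add, h, h', act_add, tmul_add]⟩

theorem coeff_tmul_one {X : Type u} (I : Submodule Rᵐᵒᵖ R) [IsDiscreteModule R (R ⧸ I)]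
    (g : free R X) (x : X) : coeff (tmul (I.mkQ 1) g) x = I.mkQ ((coeffs g).1 x) := by
  rw [coeff_tmul, ← map_smul]
  simp

variable {X : Type u} {A B : ContraMod R} (p : free R X ⟶ A) (h : A ⟶ B)

/-- The formal combinations of elements of the kernel, evaluated. -/
def kerSum {T : Type u} (σ : FormalSum R T) (k : T → ker p) : free R X :=
  (free R X).act (push (fun t => fn (kerι p) (k t)) σ)

variable {p h}

theorem kerSum_apply {T : Type u} (σ : FormalSum R T) (k : T → ker p) (x : X) :
    (coeffs (kerSum p σ k)).1 x = ∑' t, σ.1 t * (coeffs (fn (kerι p) (k t))).1 x :=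
  pair_push (Y := FormalSum R X) (fun t => fn (kerι p) (k t)) σ fun s => s.1 x

theorem fn_kerSum {T : Type u} (σ : FormalSum R T) (k : T → ker p) :
    fn p (kerSum p σ k) = 0 := by
  refine (fn_act p _).trans ?_
  rw [push_push]
  have : (fun t => fn p (fn (kerι p) (k t))) = fun _ => 0 := funext fun t => (k t).2
  rw [this, act_push_zero]

/-- One approximation step: `1 ⊗ g` lives in `L ⊙ R[[X]]` for `L` the image of `I` in `R ⧸ I'`, dies
in `L ⊙ A`, and so comes from `L ⊙ ker p` by right exactness. Elements of `L ⊙ ker p` supply weights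
in `I`. -/
theorem exists_kerSum_approx (hp : Function.Surjective (fn p)) (hh : UniversallyInjective h)
    (hB : PreservesInjections B) (I I' : Submodule Rᵐᵒᵖ R) (hI' : IsOpen (I' : Set R))
    (g : free R X) (hg : fn h (fn p g) = 0) (hgI : ∀ x, (coeffs g).1 x ∈ I) :
    ∃ σ : FormalSum R (ker p), (∀ k, σ.1 k ∈ I) ∧
      ∀ x, (coeffs g).1 x - (coeffs (kerSum p σ fun k => k)).1 x ∈ I' := by
  have := quotient_isDiscrete_of_isOpen I' hI'
  let L := I.map I'.mkQ
  have hL : ∀ x, I'.mkQ ((coeffs g).1 x) ∈ L := fun x => Submodule.mem_map_of_mem (hgI x)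
  -- The reduction of `g` modulo `I'` has finitely many nonzero coefficients, so it defines an
  -- element with values in `L`.
  obtain ⟨l, hl⟩ := exists_coeff_eq (R := R) (fun x => (⟨I'.mkQ ((coeffs g).1 x), hL x⟩ : L))
    ((finite_notMem (coeffs g) hI').subset fun x hx hx' =>
      hx (Subtype.ext ((Submodule.Quotient.mk_eq_zero I').2 hx')))
  have hl1 : tensorMap _ L.subtype l = tmul (I'.mkQ 1) g := by
    refine coeff_injective (funext fun x => ?_)
    rw [coeff_tensorMap, hl, coeff_tmul_one]
    rfl
  -- `L ⊙ A` embeds into `L ⊙ B` by universal injectivity and then into `(R ⧸ I') ⊙ B`, where the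
  -- image is `1 ⊗ h (p g) = 0`.
  have hpl : mapRight L p l = 0 := by
    refine (injective_iff_map_eq_zero _).1 (hh L) _ ?_
    refine (injective_iff_map_eq_zero _).1 (hB _ _ L.subtype L.injective_subtype) _ ?_
    rw [tensorMap_mapRight, tensorMap_mapRight, hl1, mapRight_tmul, mapRight_tmul, hg, tmul_zero]
  obtain ⟨t, ht⟩ := exists_of_mapRight_eq_zero p hp l hpl
  obtain ⟨σ, hσ, h1⟩ := exists_tmul_one _ _ _ t
  refine ⟨σ, hσ, fun x => ?_⟩
  rw [← ht, tensorMap_mapRight, h1, mapRight_tmul, fn_act] at hl1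
  have h2 := congrArg (fun z => coeff z x) hl1
  simp only [coeff_tmul_one] at h2
  rw [← Submodule.Quotient.mk_eq_zero, Submodule.Quotient.mk_sub, sub_eq_zero]
  exact h2.symm

/-- Index `0` is reserved for `J` and the countable base is shifted by one and cut down to `J`, so
that an approximation starting with coefficients in `J` never uses weights outside `J`. -/
theorem exists_antitone_ideals [(𝓝 (0 : R)).IsCountablyGenerated] (J : Submodule Rᵐᵒᵖ R)
    (hJ : IsOpen (J : Set R)) :
    ∃ I : ℕ → Submodule Rᵐᵒᵖ R, I 0 = J ∧ (∀ n, IsOpen (I n : Set R)) ∧ (∀ n, I n ≤ J) ∧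
      ∀ K : Submodule Rᵐᵒᵖ R, IsOpen (K : Set R) → ∃ n, ∀ m, n ≤ m → I m ≤ K := by
  obtain ⟨x, hx, hb⟩ :=
    (IsLinearTopology.hasBasis_open_submodule Rᵐᵒᵖ (M := R)).exists_antitone_subbasis
  refine ⟨fun n => Nat.casesOn n J fun n => J ⊓ x n, rfl, ?_, ?_, fun K hK => ?_⟩
  · rintro (_ | n)
    · exact hJ
    · exact hJ.inter (hx n)
  · rintro (_ | n)
    · exact le_rfl
    · exact inf_le_left
  · obtain ⟨n, -, hn⟩ := hb.toHasBasis.mem_iff.1 (hK.mem_nhds K.zero_mem)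
    refine ⟨n + 1, ?_⟩
    rintro (_ | m) hm
    · omega
    · exact inf_le_right.trans fun r hr => hn (hb.antitone (by omega : n ≤ m) hr)

/-- Iterating `exists_kerSum_approx` along the ideals drives the remainder to zero. The control of
the weights by `J` is what `mapRight_kerι_injective_of_isOpen` needs; for plain injectivity `J = ⊤`
suffices. -/
theorem exists_eq_kerSum [(𝓝 (0 : R)).IsCountablyGenerated] (hp : Function.Surjective (fn p))
    (hh : UniversallyInjective h) (hB : PreservesInjections B) (J : Submodule Rᵐᵒᵖ R)
    (hJ : IsOpen (J : Set R)) (g : free R X) (hg : fn h (fn p g) = 0)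
    (hgJ : ∀ x, (coeffs g).1 x ∈ J) :
    ∃ (T : Type u) (σ : FormalSum R T) (k : T → ker p), (∀ t, σ.1 t ∈ J) ∧ g = kerSum p σ k := by
  obtain ⟨I, hI0, hIo, hIJ, hI⟩ := exists_antitone_ideals J hJ
  choose σ hσ hσ' using fun (n : ℕ)
    (g : {g : free R X // fn h (fn p g) = 0 ∧ ∀ x, (coeffs g).1 x ∈ I n}) =>
      exists_kerSum_approx hp hh hB (I n) (I (n + 1)) (hIo _) g.1 g.2.1 g.2.2
  -- The remainder after `n` corrections. Corrections are killed by `p`, so the remainder stays in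
  -- the kernel of the composite and can be approximated again.
  let st : ∀ n, {g : free R X // fn h (fn p g) = 0 ∧ ∀ x, (coeffs g).1 x ∈ I n} := fun n =>
    Nat.rec ⟨g, hg, by rwa [hI0]⟩ (fun n s => ⟨s.1 - kerSum p (σ n s) fun k => k, by
      rw [fn_sub, fn_kerSum, sub_zero]
      exact s.2.1, fun x => by
      have h := hσ' n s x
      rwa [← coeffs_sub_apply] at h⟩) n
  have hst : ∀ n, (st (n + 1)).1 = (st n).1 - kerSum p (σ n (st n)) fun k => k := fun _ => rfl
  -- All corrections as one formal sum. It tends to zero because late stages have all weights in a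
  -- given open ideal, while each of the finitely many early stages is itself a null family.
  let r : FormalSum R (ℕ × ker p) := ⟨fun t => (σ t.1 (st t.1)).1 t.2, by
    rw [FormalSum.mem_iff, tendsto_zero_iff]
    intro K hK
    obtain ⟨n, hn⟩ := hI K hK
    refine ((Set.finite_lt_nat n).biUnion fun m _ =>
      (finite_notMem (σ m (st m)) hK).image (Prod.mk m)).subset ?_
    rintro ⟨m, k⟩ hmk
    simp only [Set.mem_iUnion]
    exact ⟨m, not_le.1 fun hm => hmk (hn m hm (hσ _ _ _)), k, hmk, rfl⟩⟩
  refine ⟨ℕ × ker p, r, fun t => t.2, fun t => hIJ _ (hσ _ _ _), ?_⟩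
  refine Subtype.ext (funext fun x => ?_)
  change (coeffs g).1 x = (coeffs (kerSum p r fun t => t.2)).1 x
  have hs := summable_pair r fun t => (coeffs (fn (kerι p) t.2)).1 x
  have hs1 : HasSum (fun n => (coeffs (kerSum p (σ n (st n)) fun k => k)).1 x)
      ((coeffs (kerSum p r fun t => t.2)).1 x) := by
    simp only [kerSum_apply]
    exact hs.hasSum.prod_fiberwise fun n => (hs.prod_factor n).hasSum
  -- The corrections telescope, so their partial sums converge to the coefficient of `g` as well as
  -- to that of the combined sum.
  have hsum : ∀ n, ∑ m ∈ Finset.range n, (coeffs (kerSum p (σ m (st m)) fun k => k)).1 x =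
      (coeffs g).1 x - (coeffs (st n).1).1 x := fun n => by
    induction n with
    | zero => exact (sub_self _).symm
    | succ n ih =>
      rw [Finset.sum_range_succ, ih, hst, coeffs_sub_apply]
      abel
  have ht : Filter.Tendsto (fun n => (coeffs (st n).1).1 x) Filter.atTop (𝓝 0) := by
    rw [(IsLinearTopology.hasBasis_open_submodule Rᵐᵒᵖ (M := R)).tendsto_right_iff]
    intro K hK
    obtain ⟨n, hn⟩ := hI K hK
    exact Filter.eventually_atTop.2 ⟨n, fun m hm => hn m hm ((st m).2.2 x)⟩
  have ht' := hs1.tendsto_sum_nat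
  simp only [hsum] at ht'
  have ht2 := ht.const_sub ((coeffs g).1 x)
  rw [sub_zero] at ht2
  exact tendsto_nhds_unique ht2 ht'

/-- A universally injective morphism to a contramodule preserving injections is injective. -/
theorem UniversallyInjective.injective [(𝓝 (0 : R)).IsCountablyGenerated]
    (hh : UniversallyInjective h) (hB : PreservesInjections B) : Function.Injective (fn h) := by
  have hp : Function.Surjective (fn (lift fun a : A => a)) := fun a => ⟨basis a, lift_basis _ _⟩
  refine (injective_iff_map_eq_zero (addHom h)).2 fun a ha => ?_
  obtain ⟨g, rfl⟩ := hp a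
  obtain ⟨T, σ, k, -, rfl⟩ := exists_eq_kerSum hp hh hB ⊤ isOpen_univ g ha
    fun x => Submodule.mem_top
  exact fn_kerSum σ k

end ContraMod

end

noncomputable section

namespace ContraMod

open FormalSum

variable {R : Type u} [Ring R] [UniformSpace R] [IsUniformAddGroup R] [IsTopologicalRing R]
  [CompleteSpace R] [T0Space R] [IsLinearTopology Rᵐᵒᵖ R]

section DirectSum

open DirectSum

variable {ι : Type u} {N : ι → Type u} [∀ i, AddCommGroup (N i)] [∀ i, Module Rᵐᵒᵖ (N i)]
  [∀ i, IsDiscreteModule R (N i)]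

instance directSum_isDiscrete : IsDiscreteModule R (⨁ i, N i) where
  exists_ideal b := by
    classical
    induction b using DirectSum.induction_on with
    | zero => exact ⟨⊤, isOpen_univ, fun _ _ => smul_zero _⟩
    | of i x =>
      obtain ⟨I, hI, h⟩ := IsDiscreteModule.exists_ideal (R := R) x
      refine ⟨I, hI, fun r hr => ?_⟩
      have := (DirectSum.lof Rᵐᵒᵖ ι N i).map_smul (MulOpposite.op r) x
      rw [h r hr, map_zero] at this
      exact this.symm
    | add x y hx hy =>
      obtain ⟨I, hI, h⟩ := hx
      obtain ⟨I', hI', h'⟩ := hy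
      exact ⟨I ⊓ I', hI.inter hI', fun r hr => by rw [smul_add, h r hr.1, h' r hr.2, add_zero]⟩

-- The decomposition is asserted for every finite set containing `s`, so that two such sets can be
-- merged into their union when elements are added.
open Classical in
theorem exists_eq_sum_components {P : ContraMod R} (z : ContraTensor (⨁ i, N i) P) :
    ∃ s : Finset ι, ∀ t, s ⊆ t → z = ∑ i ∈ t, tensorMap P (DirectSum.lof Rᵐᵒᵖ ι N i)
      (tensorMap P (DirectSum.component Rᵐᵒᵖ ι N i) z) := by
  have hadd : ∀ x y : ContraTensor (⨁ i, N i) P,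
      (∃ s : Finset ι, ∀ t, s ⊆ t → x = ∑ i ∈ t, tensorMap P (DirectSum.lof Rᵐᵒᵖ ι N i)
        (tensorMap P (DirectSum.component Rᵐᵒᵖ ι N i) x)) →
      (∃ s : Finset ι, ∀ t, s ⊆ t → y = ∑ i ∈ t, tensorMap P (DirectSum.lof Rᵐᵒᵖ ι N i)
        (tensorMap P (DirectSum.component Rᵐᵒᵖ ι N i) y)) →
      ∃ s : Finset ι, ∀ t, s ⊆ t → x + y = ∑ i ∈ t, tensorMap P (DirectSum.lof Rᵐᵒᵖ ι N i)
        (tensorMap P (DirectSum.component Rᵐᵒᵖ ι N i) (x + y)) := by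
    rintro x y ⟨s, hs⟩ ⟨s', hs'⟩
    refine ⟨s ∪ s', fun t ht => ?_⟩
    simp only [map_add, Finset.sum_add_distrib]
    rw [← hs t (Finset.union_subset_left ht), ← hs' t (Finset.union_subset_right ht)]
  induction z using contraTensor_induction with
  | h0 => exact ⟨∅, fun t _ => by simp⟩
  | ht b p =>
    induction b using DirectSum.induction_on with
    | zero => exact ⟨∅, fun t _ => by simp [zero_tmul]⟩
    | of i x =>
      refine ⟨{i}, fun t ht => ?_⟩
      rw [Finset.sum_eq_single i]
      · rw [← DirectSum.lof_eq_of Rᵐᵒᵖ, tensorMap_tmul, tensorMap_tmul, DirectSum.component.lof_self]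
      · intro j _ hj
        change tensorMap P _ (tensorMap P _ (tmul (DirectSum.lof Rᵐᵒᵖ ι N i x) p)) = 0
        rw [tensorMap_tmul, tensorMap_tmul, DirectSum.component.of, dif_neg hj.symm, map_zero,
          zero_tmul]
      · intro hi
        exact absurd (ht (Finset.mem_singleton_self i)) hi
    | add x y hx hy =>
      rw [add_tmul]
      exact hadd _ _ hx hy
  | ha x y hx hy => exact hadd _ _ hx hy

theorem mapRight_directSum_injective {P Q : ContraMod R} (f : P ⟶ Q)
    (hf : ∀ i, Function.Injective (mapRight (N i) f)) :
    Function.Injective (mapRight (⨁ i, N i) f) := by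
  classical
  refine (injective_iff_map_eq_zero _).2 fun z hz => ?_
  obtain ⟨s, hs⟩ := exists_eq_sum_components z
  rw [hs s subset_rfl]
  refine Finset.sum_eq_zero fun i _ => ?_
  have h : tensorMap P (DirectSum.component Rᵐᵒᵖ ι N i) z = 0 := by
    refine (injective_iff_map_eq_zero _).1 (hf i) _ ?_
    rw [← tensorMap_mapRight, hz, map_zero]
  rw [h, map_zero]

end DirectSum

section Cyclic

variable {N : Type u} [AddCommGroup N] [Module Rᵐᵒᵖ N]

/-- The module morphism `r ↦ b r`. -/
def orbitMap (b : N) : R →ₗ[Rᵐᵒᵖ] N where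
  toFun r := MulOpposite.op r • b
  map_add' r s := by rw [MulOpposite.op_add, add_smul]
  map_smul' s r := by
    rw [RingHom.id_apply, ← mul_smul]
    rfl

open DirectSum in
/-- Every discrete module is a quotient of a direct sum of cyclic discrete modules. -/
theorem exists_surjective_directSum [IsDiscreteModule R N] :
    ∃ (I : N → Submodule Rᵐᵒᵖ R), (∀ b, IsOpen (I b : Set R)) ∧
      ∃ π : (⨁ b, R ⧸ I b) →ₗ[Rᵐᵒᵖ] N, Function.Surjective π := by
  classical
  choose I hI h using fun b : N => IsDiscreteModule.exists_ideal (R := R) b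
  refine ⟨I, hI, DirectSum.toModule Rᵐᵒᵖ N N fun b => (I b).liftQ (orbitMap b)
    fun r hr => h b r hr, fun b => ⟨DirectSum.lof Rᵐᵒᵖ N (fun b => R ⧸ I b) b ((I b).mkQ 1), ?_⟩⟩
  rw [DirectSum.toModule_lof]
  change MulOpposite.op (1 : R) • b = b
  rw [MulOpposite.op_one, one_smul]

end Cyclic

theorem kerι_injective {P Q : ContraMod R} (f : P ⟶ Q) : Function.Injective (fn (kerι f)) :=
  Subtype.val_injective

theorem mapRight_zero {N : Type u} [AddCommGroup N] [Module Rᵐᵒᵖ N] [IsDiscreteModule R N]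
    {P Q : ContraMod R} : mapRight N (0 : P ⟶ Q) = 0 :=
  contraTensor_hom_ext fun b _ => tmul_zero b

/-- Diagram chase: lift `z` to `M ⊙ ker p`. Its image in `M ⊙ P` comes from `ker π ⊙ P`, and that
element vanishes in `ker π ⊙ F` because `F` preserves injections, so it comes from `ker π ⊙ ker p`.
By injectivity for `M` the lift itself comes from there, whence `z = 0`. -/
theorem mapRight_kerι_injective_of_surjective {P F : ContraMod R} {p : P ⟶ F}
    (hp : Function.Surjective (fn p)) (hF : PreservesInjections F)
    {M N : Type u} [AddCommGroup M] [Module Rᵐᵒᵖ M] [IsDiscreteModule R M] [AddCommGroup N]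
    [Module Rᵐᵒᵖ N] [IsDiscreteModule R N] (π : M →ₗ[Rᵐᵒᵖ] N) (hπ : Function.Surjective π)
    (hM : Function.Injective (mapRight M (kerι p))) :
    Function.Injective (mapRight N (kerι p)) := by
  have hexact : ∀ P : ContraMod R, Function.Exact (tensorMap P (LinearMap.ker π).subtype)
      (tensorMap P π) := fun P => tensorMap_exact P _ π
    (LinearMap.exact_iff.2 (Submodule.range_subtype _).symm) hπ
  refine (injective_iff_map_eq_zero _).2 fun z hz => ?_
  obtain ⟨z, rfl⟩ := tensorMap_surjective _ π hπ z
  rw [← tensorMap_mapRight] at hz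
  obtain ⟨l, hl⟩ := (hexact _ _).1 hz
  have hl0 : mapRight _ p l = 0 := by
    refine (injective_iff_map_eq_zero _).1 (hF _ _ _ (LinearMap.ker π).injective_subtype) _ ?_
    rw [tensorMap_mapRight, hl, ← mapRight_comp_apply, kerι_comp, mapRight_zero]
    rfl
  obtain ⟨l', rfl⟩ := exists_of_mapRight_eq_zero p hp l hl0
  rw [tensorMap_mapRight] at hl
  exact (hexact _ _).2 ⟨l', hM hl⟩

variable [(𝓝 (0 : R)).IsCountablyGenerated]

/-- Every element has the form `1 ⊗ κ`, and its vanishing in `(R ⧸ J) ⊙ R[[X]]` says that the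
coefficients of `κ` lie in `J`. Then `κ` is a combination of kernel elements with weights in `J`,
and these weights kill `1` in `R ⧸ J`. -/
theorem mapRight_kerι_injective_of_isOpen {X : Type u} {F : ContraMod R} {p : free R X ⟶ F}
    (hp : Function.Surjective (fn p)) (hF : PreservesInjections F) (J : Submodule Rᵐᵒᵖ R)
    (hJ : IsOpen (J : Set R)) [IsDiscreteModule R (R ⧸ J)] :
    Function.Injective (mapRight (R ⧸ J) (kerι p)) := by
  refine (injective_iff_map_eq_zero _).2 fun z hz => ?_
  obtain ⟨t, rfl⟩ := tensorMap_surjective (ker p) ((⊤ : Submodule Rᵐᵒᵖ R).map J.mkQ).subtype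
    (fun b => by
      obtain ⟨r, rfl⟩ := J.mkQ_surjective b
      exact ⟨⟨J.mkQ r, r, trivial, rfl⟩, rfl⟩) z
  obtain ⟨τ, -, ht⟩ := exists_tmul_one _ _ _ t
  rw [ht] at hz ⊢
  -- With `h` the identity of `F`, the approximation applies to elements of the kernel of `p`
  -- itself.
  have hid : UniversallyInjective (𝟙 F) := fun N _ _ _ => by
    rw [mapRight_id]
    exact fun _ _ h => h
  obtain ⟨T, σ, k, hσ, h⟩ := exists_eq_kerSum hp hid hF J hJ (fn (kerι p) ((ker p).act τ))
    ((ker p).act τ).2 fun x => by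
      rw [mapRight_tmul] at hz
      have h := coeff_tmul_one J (fn (kerι p) ((ker p).act τ)) x
      rw [hz, map_zero, Pi.zero_apply] at h
      exact (Submodule.Quotient.mk_eq_zero J).1 h.symm
  have hk : (ker p).act τ = (ker p).act (push k σ) := by
    refine kerι_injective p ?_
    rw [h, fn_act, push_push]
    rfl
  rw [hk, tmul_act_push]
  refine (finsum_congr fun t => ?_).trans finsum_zero
  have h0 : MulOpposite.op (σ.1 t) • J.mkQ 1 = 0 := by
    rw [← map_smul]
    refine (Submodule.Quotient.mk_eq_zero J).2 ?_
    simpa using hσ t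
  rw [h0, zero_tmul]

theorem universallyInjective_kerι {X : Type u} {F : ContraMod R} {p : free R X ⟶ F}
    (hp : Function.Surjective (fn p)) (hF : PreservesInjections F) :
    UniversallyInjective (kerι p) := fun N _ _ _ => by
  obtain ⟨I, hI, π, hπ⟩ := exists_surjective_directSum (R := R) (N := N)
  have := fun b => quotient_isDiscrete_of_isOpen (I b) (hI b)
  refine mapRight_kerι_injective_of_surjective (M := DirectSum N fun b => R ⧸ I b) hp hF π hπ ?_
  exact mapRight_directSum_injective (kerι p)
    fun b => mapRight_kerι_injective_of_isOpen hp hF (I b) (hI b)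

end ContraMod

end

/-! ### Pullbacks along epimorphisms and transfer of monomorphisms -/

section Abelian

variable {C : Type*} [Category* C] [Abelian C]

/-- In an abelian category, a pullback square along an epimorphism is a pushout square. -/
theorem isPushout_of_isPullback_of_epi {X₁ X₂ X₃ X₄ : C} {t : X₁ ⟶ X₂} {l : X₁ ⟶ X₃}
    {r : X₂ ⟶ X₄} {b : X₃ ⟶ X₄} (h : IsPullback t l r b) [Epi r] : IsPushout t l r b := by
  have hl : Epi l := MorphismProperty.of_isPullback (P := .epimorphisms C) h ‹Epi r›
  -- The kernel of `r` lifts to the pullback with zero second component, so any cocone kills it and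
  -- descends along `r`.
  have hd : ∀ s : PushoutCocone t l, kernel.ι r ≫ s.inl = 0 := fun s => by
    have hw : kernel.ι r ≫ r = 0 ≫ b := by rw [kernel.condition, zero_comp]
    rw [← h.lift_fst _ _ hw, Category.assoc, s.condition, h.lift_snd_assoc, zero_comp]
  refine ⟨⟨h.w⟩, ⟨PushoutCocone.IsColimit.mk _ (fun s => Abelian.epiDesc r s.inl (hd s))
    (fun s => Abelian.comp_epiDesc _ _ _) (fun s => ?_) fun s m hm _ => ?_⟩⟩
  · rw [← cancel_epi l, ← h.w_assoc, Abelian.comp_epiDesc, s.condition]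
  · rw [← cancel_epi r, hm, Abelian.comp_epiDesc]

/-- If `j` is the kernel of the composition of an epimorphism with the last morphism of a short
exact sequence and a functor preserving pushouts takes `j` to a monomorphism, then it takes the
first morphism of the sequence to a monomorphism. -/
theorem mono_map_of_mono_map_kernel {D : Type*} [Category* D] [Abelian D] (G : C ⥤ D)
    [PreservesColimitsOfShape WalkingSpan G] {S : ShortComplex C} (hS : S.ShortExact) {P K : C}
    (π : P ⟶ S.X₂) [Epi π] (j : K ⟶ P) (hj : j ≫ π ≫ S.g = 0)
    (hlim : IsLimit (KernelFork.ofι j hj)) [Mono (G.map j)] : Mono (G.map S.f) := by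
  have := hS.mono_f
  have hw : (j ≫ π) ≫ S.g = 0 := by rw [Category.assoc, hj]
  -- `K` is the preimage under `π` of the kernel of `S.g`, which is `S.X₁`. Being also a pushout,
  -- the square is preserved by `G`, and pushouts of monomorphisms are monomorphisms.
  have hpb : IsPullback j (hS.exact.lift (j ≫ π) hw) π S.f := by
    refine ⟨⟨(hS.exact.lift_f _ _).symm⟩, ⟨PullbackCone.IsLimit.mk _
      (fun s => hlim.lift (KernelFork.ofι s.fst (by rw [s.condition_assoc, S.zero, comp_zero])))
      (fun s => hlim.fac _ WalkingParallelPair.zero) (fun s => ?_) fun s m hm _ => ?_⟩⟩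
    · rw [← cancel_mono S.f, Category.assoc, hS.exact.lift_f, ← s.condition, ← Category.assoc]
      exact congrArg (· ≫ π) (hlim.fac _ WalkingParallelPair.zero)
    · exact Fork.IsLimit.hom_ext hlim (hm.trans (hlim.fac (KernelFork.ofι s.fst (by
        rw [s.condition_assoc, S.zero, comp_zero])) WalkingParallelPair.zero).symm)
  have hpo := (isPushout_of_isPullback_of_epi hpb).map G
  exact Abelian.mono_inr_of_isColimit _ _ hpo.isColimit

end Abelian

/-! ### Arbitrary short exact sequences and filtered colimits -/

noncomputable section

namespace ContraMod

open FormalSum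

variable {R : Type u} [Ring R] [UniformSpace R] [IsUniformAddGroup R] [IsTopologicalRing R]
  [CompleteSpace R] [T0Space R] [IsLinearTopology Rᵐᵒᵖ R]

theorem UniversallyInjective.of_mono {P Q : ContraMod R} (f : P ⟶ Q)
    (h : ∀ (N : Type u) [AddCommGroup N] [Module Rᵐᵒᵖ N] [IsDiscreteModule R N],
      Mono ((tensorFunctor R N).map f)) : UniversallyInjective f := fun N _ _ _ =>
  (AddCommGrpCat.mono_iff_injective _).1 (h N)

theorem UniversallyInjective.mono {P Q : ContraMod R} {f : P ⟶ Q} (h : UniversallyInjective f)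
    (N : Type u) [AddCommGroup N] [Module Rᵐᵒᵖ N] [IsDiscreteModule R N] :
    Mono ((tensorFunctor R N).map f) :=
  (AddCommGrpCat.mono_iff_injective _).2 (h N)

theorem mono_of_injective {P Q : ContraMod R} (f : P ⟶ Q) (hf : Function.Injective (fn f)) :
    Mono f :=
  ⟨fun _ _ e => hom_ext fun q => hf (congrArg (fun m => fn m q) e)⟩

theorem PreservesInjections.of_retract {P Q : ContraMod R} (i : P ⟶ Q) (r : Q ⟶ P)
    (h : i ≫ r = 𝟙 P) (hQ : PreservesInjections Q) :
    PreservesInjections P := fun L M _ _ _ _ _ _ f hf => by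
  refine (injective_iff_map_eq_zero _).2 fun z hz => ?_
  have h0 : mapRight L i z = 0 := by
    refine (injective_iff_map_eq_zero _).1 (hQ L M f hf) _ ?_
    rw [tensorMap_mapRight, hz, map_zero]
  have h1 : mapRight L (𝟙 P) z = 0 := by rw [← h, mapRight_comp_apply, h0, map_zero]
  rwa [mapRight_id] at h1

section Filtered

variable {J : Type u} [SmallCategory J] [IsFiltered J]

/-- As a left adjoint, `N ⊙ -` preserves the colimit, although the forgetful functor on
contramodules need not. Elements are therefore represented at some stage after tensoring. -/
theorem exists_rep_tensor {F : J ⥤ ContraMod R} {c : Cocone F} (hc : IsColimit c)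
    {N : Type u} [AddCommGroup N] [Module Rᵐᵒᵖ N] [IsDiscreteModule R N]
    (z : ContraTensor N c.pt) : ∃ (j : J) (y : ContraTensor N (F.obj j)),
      mapRight N (c.ι.app j) y = z := by
  obtain ⟨j, y, h⟩ := Concrete.isColimit_exists_rep (F ⋙ tensorFunctor R N)
    (isColimitOfPreserves (tensorFunctor R N) hc) z
  exact ⟨j, y, h⟩

theorem exists_map_eq_zero_tensor {F : J ⥤ ContraMod R} {c : Cocone F} (hc : IsColimit c)
    {N : Type u} [AddCommGroup N] [Module Rᵐᵒᵖ N] [IsDiscreteModule R N] {j : J}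
    (y : ContraTensor N (F.obj j)) (hy : mapRight N (c.ι.app j) y = 0) :
    ∃ (k : J) (f : j ⟶ k), mapRight N (F.map f) y = 0 := by
  obtain ⟨k, f, g, h⟩ := Concrete.isColimit_exists_of_rep_eq (F ⋙ tensorFunctor R N)
    (isColimitOfPreserves (tensorFunctor R N) hc) y (0 : ContraTensor N (F.obj j))
    (hy.trans (map_zero (mapRight N (c.ι.app j))).symm)
  exact ⟨k, f, h.trans (map_zero (mapRight N (F.map g)))⟩

theorem PreservesInjections.colimit {F : J ⥤ ContraMod R} {c : Cocone F} (hc : IsColimit c)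
    (hF : ∀ j, PreservesInjections (F.obj j)) :
    PreservesInjections c.pt := fun L M _ _ _ _ _ _ f hf => by
  refine (injective_iff_map_eq_zero _).2 fun z hz => ?_
  obtain ⟨j, y, rfl⟩ := exists_rep_tensor hc z
  rw [tensorMap_mapRight] at hz
  obtain ⟨k, g, hg⟩ := exists_map_eq_zero_tensor hc _ hz
  rw [← tensorMap_mapRight] at hg
  rw [← c.w g, mapRight_comp_apply, (injective_iff_map_eq_zero _).1 (hF k L M f hf) _ hg,
    map_zero]

theorem UniversallyInjective.colimMap {F G : J ⥤ ContraMod R} (α : F ⟶ G)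
    (h : ∀ j, UniversallyInjective (α.app j)) :
    UniversallyInjective (colim.map α) := fun N _ _ _ => by
  refine (injective_iff_map_eq_zero _).2 fun z hz => ?_
  obtain ⟨j, y, rfl⟩ := exists_rep_tensor (colimit.isColimit F) z
  have hι : ∀ j, colimit.ι F j ≫ colim.map α = α.app j ≫ colimit.ι G j := fun j => ι_colimMap α j
  change mapRight N (colim.map α) (mapRight N (colimit.ι F j) y) = 0 at hz
  rw [← mapRight_comp_apply, hι, mapRight_comp_apply] at hz
  obtain ⟨k, g, hg⟩ := exists_map_eq_zero_tensor (colimit.isColimit G) _ hz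
  rw [← mapRight_comp_apply, ← α.naturality, mapRight_comp_apply] at hg
  rw [← (colimit.cocone F).w g, mapRight_comp_apply,
    (injective_iff_map_eq_zero _).1 (h k N) _ hg, map_zero]

end Filtered

variable [(𝓝 (0 : R)).IsCountablyGenerated]

/-- A free cover of `S.X₂` also covers `S.X₃`; the kernel of the latter cover is universally
injective, and the pushout square passes this on to `S.f`. -/
theorem universallyInjective_of_shortExact {S : ShortComplex (ContraMod R)} (hS : S.ShortExact)
    (hF : PreservesInjections S.X₃) : UniversallyInjective S.f := by
  have := hS.epi_g
  have hπ : Function.Surjective (fn (lift fun a : S.X₂ => a)) :=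
    fun a => ⟨basis a, lift_basis _ _⟩
  have := epi_of_surjective _ hπ
  refine UniversallyInjective.of_mono _ fun N _ _ _ => ?_
  have hp := surjective_of_epi ((lift fun a : S.X₂ => a) ≫ S.g)
  have := (universallyInjective_kerι hp hF).mono N
  exact mono_map_of_mono_map_kernel (tensorFunctor R N) hS (lift fun a : S.X₂ => a)
    (kerι _) (kerι_comp _) (kerIsLimit _)

theorem PreservesInjections.of_shortExact {S : ShortComplex (ContraMod R)} (hS : S.ShortExact)
    (h₂ : PreservesInjections S.X₂) (h₃ : PreservesInjections S.X₃) :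
    PreservesInjections S.X₁ := fun L M _ _ _ _ _ _ f hf => by
  refine (injective_iff_map_eq_zero _).2 fun z hz => ?_
  refine (injective_iff_map_eq_zero _).1 (universallyInjective_of_shortExact hS h₃ L) _ ?_
  refine (injective_iff_map_eq_zero _).1 (h₂ L M f hf) _ ?_
  rw [tensorMap_mapRight, hz, map_zero]

end ContraMod

end

/-! ### Vanishing of derived functors by dimension shifting -/

section Abelian

variable {C : Type*} [Category* C] [Abelian C] {D : Type*} [Category* D] [Abelian D]

theorem exact_iff_of_comp_mono {X Y Z W : C} {f : X ⟶ Y} {q : Y ⟶ Z} {g : Y ⟶ W} (m : Z ⟶ W)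
    [Mono m] (hq : f ≫ q = 0) (hg : f ≫ g = 0) (h : q ≫ m = g) :
    (ShortComplex.mk f q hq).Exact ↔ (ShortComplex.mk f g hg).Exact := by
  let φ : ShortComplex.mk f q hq ⟶ ShortComplex.mk f g hg :=
    { τ₁ := 𝟙 _
      τ₂ := 𝟙 _
      τ₃ := m
      comm₁₂ := (Category.id_comp _).trans (Category.comp_id _).symm
      comm₂₃ := (Category.id_comp _).trans h.symm }
  have : Epi φ.τ₁ := inferInstanceAs (Epi (𝟙 _))
  have : IsIso φ.τ₂ := inferInstanceAs (IsIso (𝟙 _))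
  have : Mono φ.τ₃ := inferInstanceAs (Mono m)
  exact ShortComplex.exact_iff_of_epi_of_isIso_of_mono φ

/-- A right exact functor that takes the first morphisms of short exact sequences ending in a class
of objects to monomorphisms has no higher left derived functors on this class, provided that the
class contains the projective objects and is closed under kernels of epimorphisms. -/
theorem isZero_leftDerived_obj_of_class [HasProjectiveResolutions C] (G : C ⥤ D) [G.Additive]
    [PreservesFiniteColimits G] (good : C → Prop) (hproj : ∀ X, Projective X → good X)
    (hker : ∀ S : ShortComplex C, S.ShortExact → good S.X₂ → good S.X₃ → good S.X₁)
    (hmono : ∀ S : ShortComplex C, S.ShortExact → good S.X₃ → Mono (G.map S.f))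
    (X : C) (hX : good X) (n : ℕ) : IsZero ((G.leftDerived (n + 1)).obj X) := by
  obtain ⟨P⟩ := (inferInstance : HasProjectiveResolution X).out
  -- `Z` is the `n`-th syzygy, starting from `X` itself. The next one is `kernel q`, and it stays in
  -- the class by `hker`.
  have key : ∀ n : ℕ, ∃ (Z : C) (q : P.complex.X n ⟶ Z) (w : P.complex.d (n + 1) n ≫ q = 0),
      good Z ∧ Epi q ∧ (ShortComplex.mk _ _ w).Exact ∧
      (ShortComplex.mk (kernel.ι q) q (kernel.condition q)).ShortExact := fun n => by
    have hse : ∀ {n : ℕ} {Z : C} (q : P.complex.X n ⟶ Z) [Epi q],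
        (ShortComplex.mk (kernel.ι q) q (kernel.condition q)).ShortExact := fun q _ =>
      { exact := ShortComplex.exact_of_f_is_kernel _ (kernelIsKernel q)
        mono_f := inferInstanceAs (Mono (kernel.ι q))
        epi_g := inferInstanceAs (Epi q) }
    induction n with
    | zero =>
      have hepi : Epi (P.π.f 0) := inferInstance
      exact ⟨X, P.π.f 0, P.complex_d_comp_π_f_zero, hX, hepi,
        ShortComplex.exact_of_g_is_cokernel _ P.isColimitCokernelCofork, hse (P.π.f 0)⟩
    | succ n ih =>
      obtain ⟨Z, q, w, hZ, hq, hex, hs⟩ := ih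
      have hepi : Epi (kernel.lift q _ w) := hex.epi_kernelLift
      have hw : P.complex.d (n + 1 + 1) (n + 1) ≫ kernel.lift q _ w = 0 := by
        rw [← cancel_mono (kernel.ι q), Category.assoc, kernel.lift_ι, zero_comp,
          P.complex.d_comp_d]
      refine ⟨kernel q, kernel.lift q _ w, hw, hker _ hs (hproj _ (P.projective n)) hZ, hepi,
        ?_, hse _⟩
      exact (exact_iff_of_comp_mono (kernel.ι q) hw _ (kernel.lift_ι _ _ _)).2 (P.exact_succ n)
  refine IsZero.of_iso ?_ (P.isoLeftDerivedObj G (n + 1))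
  refine HomologicalComplex.ExactAt.isZero_homology ?_
  rw [HomologicalComplex.exactAt_iff' _ (n + 2) (n + 1) n (by simp only [ChainComplex.prev]; rfl)
    (by simp)]
  obtain ⟨Z, q, w, hZ, hq, hex, hs⟩ := key n
  have hepi : Epi (kernel.lift q _ w) := hex.epi_kernelLift
  have hw : P.complex.d (n + 2) (n + 1) ≫ kernel.lift q _ w = 0 := by
    rw [← cancel_mono (kernel.ι q), Category.assoc, kernel.lift_ι, zero_comp,
      P.complex.d_comp_d]
  have h1 : (ShortComplex.mk _ _ hw).Exact :=
    (exact_iff_of_comp_mono (kernel.ι q) hw _ (kernel.lift_ι _ _ _)).2 (P.exact_succ n)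
  -- Right exactness gives exactness at degree `n + 1` with target `G (kernel q)`; as that object
  -- embeds into `G` of degree `n`, the complex itself is exact there.
  have h2 := h1.map_of_epi_of_preservesCokernel G hepi inferInstance
  have : Mono (G.map (kernel.ι q)) := hmono _ hs hZ
  exact (exact_iff_of_comp_mono (G.map (kernel.ι q)) _ _
    ((G.map_comp _ _).symm.trans (congrArg G.map (kernel.lift_ι _ _ _)))).1 h2

theorem shortExact_of_evaluation {J : Type*} [Category* J] {S : ShortComplex (J ⥤ C)}
    (h : ∀ j, (S.map ((evaluation J C).obj j)).ShortExact) : S.ShortExact where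
  exact := by
    rw [ShortComplex.exact_iff_isZero_homology, Functor.isZero_iff]
    intro j
    exact ((ShortComplex.exact_iff_isZero_homology _).1 (h j).exact).of_iso
      (S.mapHomologyIso ((evaluation J C).obj j)).symm
  mono_f := by
    have : ∀ j, Mono (S.f.app j) := fun j => (h j).mono_f
    exact NatTrans.mono_of_mono_app _
  epi_g := by
    have : ∀ j, Epi (S.g.app j) := fun j => (h j).epi_g
    exact NatTrans.epi_of_epi_app _

end Abelian

/-! ### Colimits of diagrams of flat contramodules -/

noncomputable section

namespace ContraMod

variable {R : Type u} [Ring R] [UniformSpace R] [IsUniformAddGroup R] [IsTopologicalRing R]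
  [CompleteSpace R] [T0Space R] [IsLinearTopology Rᵐᵒᵖ R]
  {J : Type u} [SmallCategory J]

/-- A projective diagram is a retract of its free diagram, whose terms are free contramodules. -/
theorem preservesInjections_of_projective (F : J ⥤ ContraMod R) [Projective F] (j : J) :
    PreservesInjections (F.obj j) := by
  have hepi : Epi (freeDiagramLift F fun _ x => x) := by
    have hs : ∀ k, Epi ((freeDiagramLift F fun _ x => x).app k) := fun k =>
      epi_of_surjective _ fun x => ⟨basis ⟨k, 𝟙 k, x⟩, by
        rw [fn_freeDiagramLift, F.map_id, fn_id]⟩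
    exact NatTrans.epi_of_epi_app _
  have h := Projective.factorThru_comp (𝟙 F) (freeDiagramLift F fun _ x => x)
  exact PreservesInjections.of_retract _ ((freeDiagramLift F fun _ x => x).app j)
    (congrArg (fun α => α.app j) h) (preservesInjections_free _)

variable [IsFiltered J] [(𝓝 (0 : R)).IsCountablyGenerated]

/-- The injectivity criterion needs a target that preserves injections, and `S.X₂` is arbitrary. It
is applied to a projective cover of `S.X₂` instead; `colim` preserves pushouts, so the conclusion
descends to `S.f`. -/
theorem mono_colim_map {S : ShortComplex (J ⥤ ContraMod R)} (hS : S.ShortExact)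
    (hF : ∀ j, PreservesInjections (S.X₃.obj j)) :
    Mono ((colim : (J ⥤ ContraMod R) ⥤ ContraMod R).map S.f) := by
  have := hS.epi_g
  let π := Projective.π S.X₂
  have hse : (ShortComplex.mk (kernel.ι (π ≫ S.g)) _ (kernel.condition (π ≫ S.g))).ShortExact :=
    { exact := ShortComplex.exact_of_f_is_kernel _ (kernelIsKernel _)
      mono_f := inferInstanceAs (Mono (kernel.ι _))
      epi_g := inferInstanceAs (Epi (π ≫ S.g)) }
  have hu : UniversallyInjective ((colim : (J ⥤ ContraMod R) ⥤ ContraMod R).map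
      (kernel.ι (π ≫ S.g))) := UniversallyInjective.colimMap _ fun j =>
    universallyInjective_of_shortExact (hse.map_of_exact ((evaluation J (ContraMod R)).obj j))
      (hF j)
  have := mono_of_injective _ (hu.injective (PreservesInjections.colimit
    (colimit.isColimit (Projective.over S.X₂)) fun j => preservesInjections_of_projective _ j))
  exact mono_map_of_mono_map_kernel colim hS π (kernel.ι (π ≫ S.g)) (kernel.condition _)
    (kernelIsKernel _)

theorem shortExact_map_colim {S : ShortComplex (J ⥤ ContraMod R)} (hS : S.ShortExact)
    (hF : ∀ j, PreservesInjections (S.X₃.obj j)) :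
    (S.map (colim : (J ⥤ ContraMod R) ⥤ ContraMod R)).ShortExact where
  exact := hS.exact.map_of_epi_of_preservesCokernel _ hS.epi_g inferInstance
  mono_f := mono_colim_map hS hF
  epi_g := by
    have := hS.epi_g
    exact inferInstanceAs (Epi ((colim : (J ⥤ ContraMod R) ⥤ ContraMod R).map S.g))

theorem isZero_leftDerived_colim (F : J ⥤ ContraMod R) (hF : ∀ j, PreservesInjections (F.obj j))
    (n : ℕ) : IsZero (((colim : (J ⥤ ContraMod R) ⥤ ContraMod R).leftDerived (n + 1)).obj F) := by
  have h1 : ∀ F : J ⥤ ContraMod R, Projective F → ∀ j, PreservesInjections (F.obj j) :=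
    fun F _ j => preservesInjections_of_projective F j
  have h2 : ∀ S : ShortComplex (J ⥤ ContraMod R), S.ShortExact →
      (∀ j, PreservesInjections (S.X₂.obj j)) → (∀ j, PreservesInjections (S.X₃.obj j)) →
      ∀ j, PreservesInjections (S.X₁.obj j) := fun S hS h₂ h₃ j =>
    PreservesInjections.of_shortExact (hS.map_of_exact ((evaluation J (ContraMod R)).obj j))
      (h₂ j) (h₃ j)
  have h3 : ∀ S : ShortComplex (J ⥤ ContraMod R), S.ShortExact →
      (∀ j, PreservesInjections (S.X₃.obj j)) →
      Mono ((colim : (J ⥤ ContraMod R) ⥤ ContraMod R).map S.f) := fun S hS h =>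
    mono_colim_map hS h
  refine isZero_leftDerived_obj_of_class (C := J ⥤ ContraMod R) (D := ContraMod R) colim
    (fun F => ∀ j, PreservesInjections (F.obj j)) ?_ ?_ ?_ F ?_ n
  · exact h1
  · exact h2
  · exact h3
  · exact hF

end ContraMod

end

theorem mainTheorem6 (R : Type u) [Ring R] [UniformSpace R] [IsUniformAddGroup R]
    [IsTopologicalRing R] [CompleteSpace R] [T0Space R] [IsLinearTopology Rᵐᵒᵖ R]
    [(𝓝 (0 : R)).IsCountablyGenerated]
    (J : Type u) [SmallCategory J] [IsFiltered J] :
    (∀ S : ShortComplex (J ⥤ ContraMod R),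
      (∀ j, (S.map ((evaluation J (ContraMod R)).obj j)).ShortExact) →
      (∀ j, ContraMod.IsFlat (S.X₃.obj j)) →
      (S.map (colim : (J ⥤ ContraMod R) ⥤ ContraMod R)).ShortExact) ∧
    (∀ F : J ⥤ ContraMod R, (∀ j, ContraMod.IsFlat (F.obj j)) →
      ∀ n : ℕ, 1 ≤ n →
        IsZero (((colim : (J ⥤ ContraMod R) ⥤ ContraMod R).leftDerived n).obj F)) := by
  refine ⟨fun S hS hF => ContraMod.shortExact_map_colim (shortExact_of_evaluation hS)
    fun j => (hF j).preservesInjections, fun F hF n hn => ?_⟩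
  obtain ⟨n, rfl⟩ := Nat.exists_eq_add_of_le' hn
  exact ContraMod.isZero_leftDerived_colim F (fun j => (hF j).preservesInjections) n
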